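/- Let $\mathcal H$ be a complex Hilbert space, let $\mathfrak U$ be the group of unitary operators on $\mathcal H$ with the operator-norm topology and its standard real-analytic Banach manifold structure, modelled on the bounded self-adjoint operators, and let $\mathfrak T_s$ be the real Banach space of self-adjoint trace-class operators on $\mathcal H$ with the trace norm $\|A\|_1=\operatorname{Tr}|A|$. Let $0\neq\rho=\rho^*$ be a bounded operator of finite rank, $\mathcal O_\rho=\{u\rho u^*:u\in\mathfrak U\}\subset\mathfrak T_s$ its unitary orbit, and $\mathfrak U_\rho=\{u\in\mathfrak U:u\rho u^*=\rho\}$. Then $\mathcal O_\rho$ is a regularly embedded real-analytic submanifold of $\mathfrak T_s$, that is: 1. Around each point of $\mathcal O_\rho$ there is a real-analytic chart of $\mathfrak T_s$, with values in a product $F\times G$ of Banach spaces, in which $\mathcal O_\rho$ is the slice $F\times\{0\}$. 2. The quotient $\mathfrak U/\mathfrak U_\rho$, with the quotient topology, carries the structure of a real-analytic Banach manifold for which the projection $\mathfrak U\to\mathfrak U/\mathfrak U_\rho$ is an analytic submersion, and for which the injection $\iota_\rho:\mathfrak U/\mathfrak U_\rho\to\mathfrak T_s$, $u\,\mathfrak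 U_\rho\mapsto u\rho u^*$ (whose image is $\mathcal O_\rho$), is an analytic immersion and a homeomorphism onto its image. (Immersions and submersions are understood in the split sense: in suitable analytic charts they are $x\mapsto(x,0)$, respectively $(x,y)\mapsto x$.) 3. For every $\varepsilon>0$ there is $\delta>0$ such that for every $u\in\mathfrak U$ with $\|u\rho u^*-\rho\|_1<\delta$ there is $v\in\mathfrak U$ with $\|v-I\|<\varepsilon$ and $v\rho v^*=u\rho u^*$. 4. Consequently the quotient topology of $\mathfrak U/\mathfrak U_\rho$ agrees, via $\iota_\rho$, with the relative trace-norm topology of $\mathcal O_\rho$. -/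

import Mathlib

open scoped InnerProductSpace ContDiff Manifold Topology

universe u

namespace UnitaryOrbit

section TraceNorm

variable {H : Type u} [NormedAddCommGroup H] [InnerProductSpace ℂ H] [CompleteSpace H]

variable (H) in
/-- Every Hilbert space has an orthonormal basis. -/
theorem exists_basis : ∃ (w : Set H) (b : HilbertBasis w ℂ H), ⇑b = ((↑) : w → H) :=
  exists_hilbertBasis ℂ H

variable (H) in
/-- The index set of the chosen orthonormal basis. -/
def basisSet : Set H := (exists_basis H).choose

variable (H) in
/-- An orthonormal basis of `H`, fixed once and for all. -/
noncomputable def onb : HilbertBasis (basisSet H) ℂ H := (exists_basis H).choose_spec.choose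

/-- `A` is of trace class: `Tr |A| < ∞`, where `|A| = (A* A)^(1/2)`. -/
def IsTraceClass (A : H →L[ℂ] H) : Prop :=
  Summable fun i => RCLike.re ⟪onb H i, CFC.abs A (onb H i)⟫_ℂ

/-- The trace norm `‖A‖₁ = Tr |A|` (meaningful for `A` of trace class). -/
noncomputable def traceNorm (A : H →L[ℂ] H) : ℝ :=
  ∑' i, RCLike.re ⟪onb H i, CFC.abs A (onb H i)⟫_ℂ

theorem abs_isPositive (A : H →L[ℂ] H) : (CFC.abs A).IsPositive :=
  (ContinuousLinearMap.nonneg_iff_isPositive _).1 (CFC.abs_nonneg A)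

theorem re_abs_nonneg (A : H →L[ℂ] H) (x : H) : 0 ≤ RCLike.re ⟪x, CFC.abs A x⟫_ℂ :=
  (abs_isPositive A).re_inner_nonneg_right x

theorem traceNorm_nonneg (A : H →L[ℂ] H) : 0 ≤ traceNorm A :=
  tsum_nonneg fun _ => re_abs_nonneg A _

theorem norm_abs_apply (A : H →L[ℂ] H) (x : H) : ‖CFC.abs A x‖ = ‖A x‖ := by
  have h : ⟪CFC.abs A x, CFC.abs A x⟫_ℂ = ⟪A x, A x⟫_ℂ := by
    have hs := (abs_isPositive A).isSelfAdjoint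
    have h1 : ⟪CFC.abs A x, CFC.abs A x⟫_ℂ = ⟪x, (CFC.abs A * CFC.abs A) x⟫_ℂ := by
      conv_lhs => rw [← ContinuousLinearMap.adjoint_inner_right]
      rw [← ContinuousLinearMap.star_eq_adjoint, hs.star_eq]; rfl
    rw [h1, CFC.abs_mul_abs, mul_apply_eq_comp, ContinuousLinearMap.star_eq_adjoint,
      ContinuousLinearMap.adjoint_inner_right]
  rw [inner_self_eq_norm_sq_to_K, inner_self_eq_norm_sq_to_K] at h
  have h' : ‖CFC.abs A x‖ ^ 2 = ‖A x‖ ^ 2 := by exact_mod_cast h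
  exact (sq_eq_sq₀ (norm_nonneg _) (norm_nonneg _)).1 h'

/-- Square root of `|A|`. -/
theorem exists_sqrt_abs (A : H →L[ℂ] H) : ∃ S : H →L[ℂ] H, IsSelfAdjoint S ∧ S * S = CFC.abs A :=
  ⟨CFC.sqrt (CFC.abs A), (CFC.sqrt_nonneg _).isSelfAdjoint,
    CFC.sqrt_mul_sqrt_self _ (CFC.abs_nonneg A)⟩

theorem inner_selfAdjoint {S : H →L[ℂ] H} (hS : IsSelfAdjoint S) (x y : H) :
    ⟪S x, y⟫_ℂ = ⟪x, S y⟫_ℂ := by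
  rw [← ContinuousLinearMap.adjoint_inner_right, ← ContinuousLinearMap.star_eq_adjoint, hS.star_eq]

/-- An approximate polar decomposition. -/
theorem approx_polar (A : H →L[ℂ] H) {ε : ℝ} (hε : 0 < ε) :
    ∃ V : H →L[ℂ] H, ‖V‖ ≤ 1 ∧ A = V * CFC.abs A + (ε : ℂ) • V ∧
      ∀ x, RCLike.re ⟪x, CFC.abs A x⟫_ℂ ≤ RCLike.re ⟪V x, A x⟫_ℂ + ε * ‖x‖ ^ 2 := by
  set P := CFC.abs A with hP
  have hPs : IsSelfAdjoint P := (abs_isPositive A).isSelfAdjoint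
  have hunit : IsUnit (P + (ε : ℂ) • (1 : H →L[ℂ] H)) := by
    have h0 : (0 : H →L[ℂ] H) ≤ P := CFC.abs_nonneg A
    have hsp : ((-ε : ℝ) : ℝ) ∉ spectrum ℝ P := by
      intro h
      have := spectrum_nonneg_of_nonneg h0 h
      linarith
    rw [spectrum.notMem_iff] at hsp
    have h2 : (algebraMap ℝ (H →L[ℂ] H)) (-ε) - P = -(P + (ε : ℂ) • (1 : H →L[ℂ] H)) := by
      ext x
      simp [Algebra.algebraMap_eq_smul_one]
      abel
    rw [h2] at hsp
    simpa using hsp.neg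
  obtain ⟨U, hU⟩ := hunit
  set R : H →L[ℂ] H := ↑U⁻¹ with hR
  have hPR : P * R + (ε : ℂ) • R = 1 := by
    have : (P + (ε : ℂ) • (1 : H →L[ℂ] H)) * R = 1 := by rw [← hU]; simp [hR]
    simpa [add_mul] using this
  have hRP : R * P + (ε : ℂ) • R = 1 := by
    have : R * (P + (ε : ℂ) • (1 : H →L[ℂ] H)) = 1 := by rw [← hU]; simp [hR]
    simpa [mul_add] using this
  have hPRx : ∀ x, ‖P (R x)‖ ≤ ‖x‖ := by
    intro x
    have hx : P (R x) + (ε : ℂ) • R x = x := by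
      simpa using congrArg (fun T : H →L[ℂ] H => T x) hPR
    have h1 : ‖P (R x) + (ε : ℂ) • R x‖ ^ 2 = ‖P (R x)‖ ^ 2
        + 2 * RCLike.re ⟪P (R x), (ε : ℂ) • R x⟫_ℂ + ‖(ε : ℂ) • R x‖ ^ 2 :=
      norm_add_sq (𝕜 := ℂ) _ _
    have h2 : 0 ≤ RCLike.re ⟪P (R x), (ε : ℂ) • R x⟫_ℂ := by
      rw [inner_smul_right, inner_selfAdjoint hPs]
      have := re_abs_nonneg A (R x)
      simp only [RCLike.re_to_complex, Complex.re_ofReal_mul] at this ⊢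
      positivity
    rw [hx] at h1
    have h3 : ‖P (R x)‖ ^ 2 ≤ ‖x‖ ^ 2 := by nlinarith [sq_nonneg ‖(ε : ℂ) • R x‖]
    exact (sq_le_sq₀ (norm_nonneg _) (norm_nonneg _)).1 h3
  refine ⟨A * R, ?_, ?_, ?_⟩
  · refine ContinuousLinearMap.opNorm_le_bound _ zero_le_one fun x => ?_
    rw [one_mul, mul_apply_eq_comp, ← norm_abs_apply]
    exact hPRx x
  · calc A = A * (R * P + (ε : ℂ) • R) := by rw [hRP, mul_one]
      _ = _ := by rw [mul_add, mul_assoc, mul_smul_comm]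
  · intro x
    have h1 : ⟪(A * R) x, A x⟫_ℂ = ⟪P (R x), P x⟫_ℂ := by
      have : star A * A = P * P := (CFC.abs_mul_abs A).symm
      rw [mul_apply_eq_comp, ← ContinuousLinearMap.adjoint_inner_right,
        ← ContinuousLinearMap.star_eq_adjoint, ← mul_apply_eq_comp, this,
        inner_selfAdjoint hPs]; rfl
    have hx : P (R x) = x - (ε : ℂ) • R x := by
      have : P (R x) + (ε : ℂ) • R x = x := by
        simpa using congrArg (fun T : H →L[ℂ] H => T x) hPR
      exact eq_sub_of_add_eq this
    have h3 : RCLike.re ⟪(A * R) x, A x⟫_ℂ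
        = RCLike.re ⟪x, P x⟫_ℂ - ε * RCLike.re ⟪P (R x), x⟫_ℂ := by
      rw [h1, hx, inner_sub_left, map_sub, inner_smul_left, ← inner_selfAdjoint hPs (R x), ← hx]
      simp
    have h4 : RCLike.re ⟪P (R x), x⟫_ℂ ≤ ‖x‖ ^ 2 := by
      refine (re_inner_le_norm _ _).trans ?_
      nlinarith [hPRx x, norm_nonneg x]
    rw [h3]
    nlinarith

/-- Hilbert-Schmidt estimate. -/
theorem sum_norm_sq_le {ι κ : Type*} (e : HilbertBasis κ ℂ H) {b : ι → H} (hb : Orthonormal ℂ b)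
    (s : Finset ι) {S T : H →L[ℂ] H} (hS : IsSelfAdjoint S) (hT : ‖T‖ ≤ 1)
    (hsum : Summable fun j => ‖S (e j)‖ ^ 2) :
    ∑ i ∈ s, ‖S (T (b i))‖ ^ 2 ≤ ∑' j, ‖S (e j)‖ ^ 2 := by
  have hpars : ∀ x : H, HasSum (fun j => ‖⟪e j, x⟫_ℂ‖ ^ 2) (‖x‖ ^ 2) := by
    intro x
    have h := e.hasSum_inner_mul_inner x x
    rw [inner_self_eq_norm_sq_to_K] at h
    have h2 : (fun i => ⟪x, e i⟫_ℂ * ⟪e i, x⟫_ℂ) = fun i => ((‖⟪e i, x⟫_ℂ‖ ^ 2 : ℝ) : ℂ) := by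
      funext i
      rw [← inner_conj_symm x (e i), RCLike.conj_mul]
      simp
    rw [h2] at h
    have h3 : ((‖x‖ : ℂ)) ^ 2 = ((‖x‖ ^ 2 : ℝ) : ℂ) := by push_cast; rfl
    erw [h3] at h
    exact Complex.hasSum_ofReal.1 h
  have h1 : HasSum (fun j => ∑ i ∈ s, ‖⟪e j, S (T (b i))⟫_ℂ‖ ^ 2)
      (∑ i ∈ s, ‖S (T (b i))‖ ^ 2) := hasSum_sum fun i _ => hpars _
  refine hasSum_le (fun j => ?_) h1 hsum.hasSum
  have h2 : ∀ i, ‖⟪e j, S (T (b i))⟫_ℂ‖ = ‖⟪b i, ContinuousLinearMap.adjoint T (S (e j))⟫_ℂ‖ := by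
    intro i
    rw [← inner_selfAdjoint hS, ← ContinuousLinearMap.adjoint_inner_left, norm_inner_symm]
  simp only [h2]
  refine (hb.sum_inner_products_le _).trans ?_
  have h3 : ‖ContinuousLinearMap.adjoint T (S (e j))‖ ≤ ‖S (e j)‖ := by
    refine (ContinuousLinearMap.le_opNorm _ _).trans ?_
    rw [LinearIsometryEquiv.norm_map]
    nlinarith [norm_nonneg (S (e j))]
  gcongr

theorem re_abs_eq {A S : H →L[ℂ] H} (hS : IsSelfAdjoint S) (h : S * S = CFC.abs A) (x : H) :
    RCLike.re ⟪x, CFC.abs A x⟫_ℂ = ‖S x‖ ^ 2 := by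
  rw [← h, mul_apply_eq_comp, ← inner_selfAdjoint hS, inner_self_eq_norm_sq]

/-- The variational upper bound for the trace norm, with respect to any orthonormal basis. -/
theorem sum_inner_le_tsum {ι κ : Type*} (e : HilbertBasis κ ℂ H) {A W : H →L[ℂ] H}
    (hA : Summable fun j => RCLike.re ⟪e j, CFC.abs A (e j)⟫_ℂ) (hW : ‖W‖ ≤ 1) {b : ι → H}
    (hb : Orthonormal ℂ b) (s : Finset ι) :
    ∑ i ∈ s, ‖⟪W (b i), A (b i)⟫_ℂ‖ ≤ ∑' j, RCLike.re ⟪e j, CFC.abs A (e j)⟫_ℂ := by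
  obtain ⟨S, hS, hSS⟩ := exists_sqrt_abs A
  simp only [re_abs_eq hS hSS] at hA ⊢
  set N := ∑' j, ‖S (e j)‖ ^ 2 with hN
  refine le_of_forall_pos_le_add fun δ hδ => ?_
  set ε : ℝ := δ / (s.card + 1) with hεd
  have hε : 0 < ε := by positivity
  obtain ⟨V, hV, hAV, -⟩ := approx_polar A hε
  have hVW : ‖ContinuousLinearMap.adjoint V * W‖ ≤ 1 := by
    refine (norm_mul_le _ _).trans ?_
    rw [LinearIsometryEquiv.norm_map]
    nlinarith [norm_nonneg V, norm_nonneg W]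
  have hterm : ∀ i ∈ s, ‖⟪W (b i), A (b i)⟫_ℂ‖ ≤
      (‖S ((ContinuousLinearMap.adjoint V * W) (b i))‖ ^ 2 + ‖S (b i)‖ ^ 2) / 2 + ε := by
    intro i _
    have hbi : ‖b i‖ = 1 := hb.1 i
    have h1 : A (b i) = V (S (S (b i))) + (ε : ℂ) • V (b i) := by
      have := congrArg (fun T : H →L[ℂ] H => T (b i)) hAV
      rw [← hSS] at this
      simpa using this
    rw [h1, inner_add_right]
    refine (norm_add_le _ _).trans (add_le_add ?_ ?_)
    · rw [← ContinuousLinearMap.adjoint_inner_left, ← inner_selfAdjoint hS]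
      refine (norm_inner_le_norm _ _).trans ?_
      rw [mul_apply_eq_comp]
      nlinarith [sq_nonneg (‖S ((ContinuousLinearMap.adjoint V) (W (b i)))‖ - ‖S (b i)‖)]
    · rw [inner_smul_right, norm_mul, Complex.norm_real, Real.norm_of_nonneg hε.le]
      have h2 : ‖W (b i)‖ ≤ 1 := (W.le_opNorm _).trans (by rw [hbi]; linarith)
      have h3 : ‖V (b i)‖ ≤ 1 := (V.le_opNorm _).trans (by rw [hbi]; linarith)
      have h4 := norm_inner_le_norm (𝕜 := ℂ) (W (b i)) (V (b i))
      have h5 : ‖⟪W (b i), V (b i)⟫_ℂ‖ ≤ 1 :=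
        h4.trans (by nlinarith [norm_nonneg (W (b i)), norm_nonneg (V (b i))])
      nlinarith
  refine (Finset.sum_le_sum hterm).trans ?_
  rw [Finset.sum_add_distrib, ← Finset.sum_div, Finset.sum_add_distrib, Finset.sum_const,
    nsmul_eq_mul]
  have h1 := sum_norm_sq_le e hb s hS hVW hA
  have h2 := sum_norm_sq_le e hb s (T := 1) hS ContinuousLinearMap.norm_id_le hA
  simp only [one_apply_eq_self] at h2
  have h3 : (s.card : ℝ) * ε ≤ δ := by
    have h4 : ((s.card : ℝ) + 1) * ε = δ := mul_div_cancel₀ δ (Nat.cast_add_one_ne_zero s.card)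
    linarith
  linarith

/-- The variational lower bound for the trace norm, with respect to any orthonormal family. -/
theorem sum_abs_le_of_bound {κ : Type*} {A : H →L[ℂ] H} {C : ℝ} {e : κ → H}
    (he : Orthonormal ℂ e) (s : Finset κ)
    (h : ∀ W : H →L[ℂ] H, ‖W‖ ≤ 1 → ∑ i ∈ s, ‖⟪W (e i), A (e i)⟫_ℂ‖ ≤ C) :
    ∑ i ∈ s, RCLike.re ⟪e i, CFC.abs A (e i)⟫_ℂ ≤ C := by
  refine le_of_forall_pos_le_add fun δ hδ => ?_
  set ε : ℝ := δ / (s.card + 1) with hεd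
  have hε : 0 < ε := by positivity
  obtain ⟨V, hV, -, hAV⟩ := approx_polar A hε
  have hterm : ∀ i ∈ s, RCLike.re ⟪e i, CFC.abs A (e i)⟫_ℂ ≤ ‖⟪V (e i), A (e i)⟫_ℂ‖ + ε := by
    intro i _
    have := hAV (e i)
    rw [he.1 i] at this
    have h2 : RCLike.re ⟪V (e i), A (e i)⟫_ℂ ≤ ‖⟪V (e i), A (e i)⟫_ℂ‖ := RCLike.re_le_norm _
    linarith
  refine (Finset.sum_le_sum hterm).trans ?_
  rw [Finset.sum_add_distrib, Finset.sum_const, nsmul_eq_mul]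
  have h3 : (s.card : ℝ) * ε ≤ δ := by
    have h4 : ((s.card : ℝ) + 1) * ε = δ := mul_div_cancel₀ δ (Nat.cast_add_one_ne_zero s.card)
    linarith
  linarith [h V hV]

theorem isTraceClass_of_bound {A : H →L[ℂ] H} {C : ℝ}
    (h : ∀ W : H →L[ℂ] H, ‖W‖ ≤ 1 → ∀ s : Finset (basisSet H),
      ∑ i ∈ s, ‖⟪W (onb H i), A (onb H i)⟫_ℂ‖ ≤ C) :
    IsTraceClass A ∧ traceNorm A ≤ C := by
  have hs : ∀ s : Finset (basisSet H),
      ∑ i ∈ s, RCLike.re ⟪onb H i, CFC.abs A (onb H i)⟫_ℂ ≤ C :=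
    fun s => sum_abs_le_of_bound (onb H).orthonormal s fun W hW => h W hW s
  have hsum : IsTraceClass A := summable_of_sum_le (fun _ => re_abs_nonneg A _) hs
  exact ⟨hsum, hsum.tsum_le_of_sum_le hs⟩

theorem sum_inner_le {ι : Type*} {A W : H →L[ℂ] H} (hA : IsTraceClass A) (hW : ‖W‖ ≤ 1)
    {b : ι → H} (hb : Orthonormal ℂ b) (s : Finset ι) :
    ∑ i ∈ s, ‖⟪W (b i), A (b i)⟫_ℂ‖ ≤ traceNorm A :=
  sum_inner_le_tsum (onb H) hA hW hb s

/-- The trace `Tr |A|` does not depend on the orthonormal basis: it may be computed in any one. -/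
theorem hasSum_traceNorm {κ : Type*} (e : HilbertBasis κ ℂ H) {A : H →L[ℂ] H}
    (hA : IsTraceClass A) :
    HasSum (fun j => RCLike.re ⟪e j, CFC.abs A (e j)⟫_ℂ) (traceNorm A) := by
  have h1 : ∀ s : Finset κ, ∑ i ∈ s, RCLike.re ⟪e i, CFC.abs A (e i)⟫_ℂ ≤ traceNorm A :=
    fun s => sum_abs_le_of_bound e.orthonormal s fun W hW => sum_inner_le hA hW e.orthonormal s
  have hsum : Summable fun j => RCLike.re ⟪e j, CFC.abs A (e j)⟫_ℂ :=
    summable_of_sum_le (fun _ => re_abs_nonneg A _) h1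
  have h2 : traceNorm A ≤ ∑' j, RCLike.re ⟪e j, CFC.abs A (e j)⟫_ℂ :=
    (isTraceClass_of_bound fun W hW s =>
      sum_inner_le_tsum e hsum hW (onb H).orthonormal s).2
  rw [le_antisymm h2 (hsum.tsum_le_of_sum_le h1)]
  exact hsum.hasSum

/-- Being of trace class does not depend on the orthonormal basis. -/
theorem isTraceClass_iff {κ : Type*} (e : HilbertBasis κ ℂ H) (A : H →L[ℂ] H) :
    IsTraceClass A ↔ Summable fun j => RCLike.re ⟪e j, CFC.abs A (e j)⟫_ℂ :=
  ⟨fun h => (hasSum_traceNorm e h).summable, fun h =>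
    (isTraceClass_of_bound fun _ hW s => sum_inner_le_tsum e h hW (onb H).orthonormal s).1⟩

theorem norm_le_traceNorm {A : H →L[ℂ] H} (hA : IsTraceClass A) : ‖A‖ ≤ traceNorm A := by
  refine ContinuousLinearMap.opNorm_le_of_unit_norm (traceNorm_nonneg A) fun x hx => ?_
  by_cases hAx : A x = 0
  · rw [hAx, norm_zero]; exact traceNorm_nonneg A
  have hAx' : ‖A x‖ ≠ 0 := norm_ne_zero_iff.2 hAx
  set y : H := ((‖A x‖⁻¹ : ℝ) : ℂ) • A x with hy
  have hyn : ‖y‖ = 1 := by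
    rw [hy, norm_smul, Complex.norm_real, norm_inv, norm_norm, inv_mul_cancel₀ hAx']
  set W : H →L[ℂ] H := (innerSL ℂ x).smulRight y with hWd
  have hW : ‖W‖ ≤ 1 := by
    rw [hWd, ContinuousLinearMap.norm_smulRight_apply, innerSL_apply_norm, hx, hyn, one_mul]
  have hWx : W x = y := by
    simp [hWd, inner_self_eq_norm_sq_to_K, hx]
  have hb : Orthonormal ℂ (fun _ : Unit => x) := ⟨fun _ => hx, fun i j hij => (hij rfl).elim⟩
  have := sum_inner_le hA hW hb {()}
  rw [Finset.sum_singleton, hWx, hy, inner_smul_left, inner_self_eq_norm_sq_to_K, norm_mul] at this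
  refine le_trans (le_of_eq ?_) this
  simp
  field_simp

theorem isTraceClass_zero : IsTraceClass (0 : H →L[ℂ] H) :=
  (isTraceClass_of_bound (C := 0) fun W _ s => by simp).1

theorem isTraceClass_add {A B : H →L[ℂ] H} (hA : IsTraceClass A) (hB : IsTraceClass B) :
    IsTraceClass (A + B) ∧ traceNorm (A + B) ≤ traceNorm A + traceNorm B :=
  isTraceClass_of_bound fun W hW s => by
    refine le_trans (Finset.sum_le_sum fun i _ => ?_)
      (le_trans (Finset.sum_add_distrib (f := fun i => ‖⟪W (onb H i), A (onb H i)⟫_ℂ‖)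
        (g := fun i => ‖⟪W (onb H i), B (onb H i)⟫_ℂ‖)).le
      (add_le_add (sum_inner_le hA hW (onb H).orthonormal s)
        (sum_inner_le hB hW (onb H).orthonormal s)))
    rw [add_apply, inner_add_right]
    exact norm_add_le _ _

theorem isTraceClass_smul (c : ℝ) {A : H →L[ℂ] H} (hA : IsTraceClass A) :
    IsTraceClass (c • A) ∧ traceNorm (c • A) ≤ |c| * traceNorm A :=
  isTraceClass_of_bound fun W hW s => by
    have h : ∀ i, ‖⟪W (onb H i), (c • A) (onb H i)⟫_ℂ‖ = |c| * ‖⟪W (onb H i), A (onb H i)⟫_ℂ‖ := by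
      intro i
      rw [smul_apply, inner_smul_right_eq_smul, norm_smul, Real.norm_eq_abs]
    simp only [h]
    rw [← Finset.mul_sum]
    exact mul_le_mul_of_nonneg_left (sum_inner_le hA hW (onb H).orthonormal s) (abs_nonneg c)

/-- Conjugation by a unitary preserves the trace class. -/
theorem isTraceClass_conj (u : unitary (H →L[ℂ] H)) {A : H →L[ℂ] H} (hA : IsTraceClass A) :
    IsTraceClass ((u : H →L[ℂ] H) * A * star (u : H →L[ℂ] H)) ∧
      traceNorm ((u : H →L[ℂ] H) * A * star (u : H →L[ℂ] H)) ≤ traceNorm A := by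
  classical
  set U : H →L[ℂ] H := (u : H →L[ℂ] H) with hU
  have hUU : U * star U = 1 := Unitary.mul_star_self_of_mem u.2
  have hinner : ∀ x y, ⟪x, U y⟫_ℂ = ⟪star U x, y⟫_ℂ := fun x y => by
    rw [ContinuousLinearMap.star_eq_adjoint, ContinuousLinearMap.adjoint_inner_left]
  have hb : Orthonormal ℂ (fun i => star U (onb H i)) := by
    rw [orthonormal_iff_ite]
    intro i j
    have : U (star U (onb H j)) = onb H j := congrArg (fun T : H →L[ℂ] H => T (onb H j)) hUU
    rw [← hinner, this]
    exact orthonormal_iff_ite.1 (onb H).orthonormal i j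
  refine isTraceClass_of_bound fun W hW s => ?_
  have hW' : ‖star U * W * U‖ ≤ 1 := by
    have hn : ‖U‖ ≤ 1 := by
      refine ContinuousLinearMap.opNorm_le_bound _ zero_le_one fun x => ?_
      have h1 : star U * U = 1 := Unitary.star_mul_self_of_mem u.2
      have h2 : star U (U x) = x := congrArg (fun T : H →L[ℂ] H => T x) h1
      have h3 : ⟪U x, U x⟫_ℂ = ⟪x, x⟫_ℂ := by rw [hinner, h2]
      rw [inner_self_eq_norm_sq_to_K, inner_self_eq_norm_sq_to_K] at h3
      have h4 : ‖U x‖ ^ 2 = ‖x‖ ^ 2 := by exact_mod_cast h3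
      rw [one_mul, (sq_eq_sq₀ (norm_nonneg _) (norm_nonneg _)).1 h4]
    have hn' : ‖star U‖ ≤ 1 := by rwa [norm_star]
    calc ‖star U * W * U‖ ≤ ‖star U * W‖ * ‖U‖ := norm_mul_le _ _
      _ ≤ (‖star U‖ * ‖W‖) * ‖U‖ := by gcongr; exact norm_mul_le _ _
      _ ≤ (1 * 1) * 1 := by gcongr
      _ = 1 := by norm_num
  refine le_trans (Finset.sum_le_sum fun i _ => ?_) (sum_inner_le hA hW' hb s)
  have h1 : U (star U (onb H i)) = onb H i := congrArg (fun T : H →L[ℂ] H => T (onb H i)) hUU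
  simp only [mul_apply_eq_comp, h1, hinner]
  exact le_rfl

/-- Operators of finite rank are of trace class. -/
theorem isTraceClass_of_finiteRank {A : H →L[ℂ] H} (hA : FiniteDimensional ℂ A.range) :
    IsTraceClass A := by
  set g := stdOrthonormalBasis ℂ A.range with hg
  have hAx : ∀ x, A x = ∑ k, ⟪(g k : H), A x⟫_ℂ • (g k : H) := by
    intro x
    have h := g.sum_repr' ⟨A x, LinearMap.mem_range_self _ x⟩
    have h2 := congrArg (Subtype.val) h
    simpa using h2.symm
  refine (isTraceClass_of_bound (C := ∑ k, (‖ContinuousLinearMap.adjoint A (g k : H)‖ ^ 2 + 1) / 2)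
    fun W hW s => ?_).1
  have hterm : ∀ i ∈ s, ‖⟪W (onb H i), A (onb H i)⟫_ℂ‖ ≤
      ∑ k, (‖⟪onb H i, ContinuousLinearMap.adjoint A (g k : H)⟫_ℂ‖ ^ 2
        + ‖⟪onb H i, ContinuousLinearMap.adjoint W (g k : H)⟫_ℂ‖ ^ 2) / 2 := by
    intro i _
    rw [hAx, inner_sum]
    refine (norm_sum_le _ _).trans (Finset.sum_le_sum fun k _ => ?_)
    have e1 : ⟪(g k : H), A (onb H i)⟫_ℂ
        = ⟪ContinuousLinearMap.adjoint A (g k : H), onb H i⟫_ℂ :=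
      (ContinuousLinearMap.adjoint_inner_left _ _ _).symm
    have e2 : ⟪W (onb H i), (g k : H)⟫_ℂ
        = ⟪onb H i, ContinuousLinearMap.adjoint W (g k : H)⟫_ℂ :=
      (ContinuousLinearMap.adjoint_inner_right _ _ _).symm
    rw [inner_smul_right, norm_mul, e1, e2, norm_inner_symm]
    nlinarith [sq_nonneg (‖⟪onb H i, ContinuousLinearMap.adjoint A (g k : H)⟫_ℂ‖
      - ‖⟪onb H i, ContinuousLinearMap.adjoint W (g k : H)⟫_ℂ‖)]
  refine (Finset.sum_le_sum hterm).trans ?_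
  rw [Finset.sum_comm]
  refine Finset.sum_le_sum fun k _ => ?_
  rw [← Finset.sum_div, Finset.sum_add_distrib]
  have h1 := (onb H).orthonormal.sum_inner_products_le (ContinuousLinearMap.adjoint A (g k : H))
    (s := s)
  have h2 := (onb H).orthonormal.sum_inner_products_le (ContinuousLinearMap.adjoint W (g k : H))
    (s := s)
  have h3 : ‖ContinuousLinearMap.adjoint W (g k : H)‖ ≤ 1 := by
    refine (ContinuousLinearMap.le_opNorm _ _).trans ?_
    have : ‖(g k : H)‖ = 1 := g.orthonormal.1 k
    rw [LinearIsometryEquiv.norm_map, this]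
    linarith
  have h4 : ‖ContinuousLinearMap.adjoint W (g k : H)‖ ^ 2 ≤ 1 := by
    nlinarith [norm_nonneg (ContinuousLinearMap.adjoint W (g k : H))]
  linarith

end TraceNorm

section Space

variable (H : Type u) [NormedAddCommGroup H] [InnerProductSpace ℂ H] [CompleteSpace H]

/-- The real vector space of self-adjoint trace-class operators on `H`. -/
def saTraceClassSubmodule : Submodule ℝ (H →L[ℂ] H) where
  carrier := {A | IsSelfAdjoint A ∧ IsTraceClass A}
  zero_mem' := ⟨IsSelfAdjoint.zero _, isTraceClass_zero⟩
  add_mem' := fun hA hB => ⟨hA.1.add hB.1, (isTraceClass_add hA.2 hB.2).1⟩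
  smul_mem' := fun c _ hA => ⟨(IsSelfAdjoint.all c).smul hA.1, (isTraceClass_smul c hA.2).1⟩

/-- The space `𝔗_s` of self-adjoint trace-class operators on `H`. It is a type synonym of a
subspace of the bounded operators, since it does not carry the operator norm but the trace norm. -/
def SATraceClass : Type u := saTraceClassSubmodule H

noncomputable instance : AddCommGroup (SATraceClass H) :=
  inferInstanceAs (AddCommGroup (saTraceClassSubmodule H))

noncomputable instance : Module ℝ (SATraceClass H) :=
  inferInstanceAs (Module ℝ (saTraceClassSubmodule H))

variable {H}

namespace SATraceClass

/-- The operator underlying an element of `𝔗_s`. -/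
def op (A : SATraceClass H) : H →L[ℂ] H := Subtype.val A

/-- A self-adjoint trace-class operator as an element of `𝔗_s`. -/
def mk (A : H →L[ℂ] H) (hA : IsSelfAdjoint A) (hA' : IsTraceClass A) : SATraceClass H :=
  ⟨A, hA, hA'⟩

theorem isSelfAdjoint (A : SATraceClass H) : IsSelfAdjoint A.op := A.2.1

theorem isTraceClass (A : SATraceClass H) : IsTraceClass A.op := A.2.2

@[ext] theorem ext {A B : SATraceClass H} (h : A.op = B.op) : A = B := Subtype.ext h

@[simp] theorem op_mk (A : H →L[ℂ] H) (hA : IsSelfAdjoint A) (hA' : IsTraceClass A) :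
    (mk A hA hA').op = A := rfl

@[simp] theorem op_zero : (0 : SATraceClass H).op = 0 := rfl

@[simp] theorem op_add (A B : SATraceClass H) : (A + B).op = A.op + B.op := rfl

@[simp] theorem op_sub (A B : SATraceClass H) : (A - B).op = A.op - B.op := rfl

@[simp] theorem op_smul (c : ℝ) (A : SATraceClass H) : (c • A).op = c • A.op := rfl

/-- The norm of `𝔗_s` is the trace norm. -/
noncomputable instance : Norm (SATraceClass H) := ⟨fun A => traceNorm A.op⟩

theorem norm_def (A : SATraceClass H) : ‖A‖ = traceNorm A.op := rfl

theorem norm_op_le (A : SATraceClass H) : ‖A.op‖ ≤ ‖A‖ := norm_le_traceNorm A.isTraceClass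

theorem core : NormedSpace.Core ℝ (SATraceClass H) where
  norm_nonneg A := traceNorm_nonneg A.op
  norm_smul c A := by
    have hle : ∀ (c : ℝ) (A : SATraceClass H), ‖c • A‖ ≤ ‖c‖ * ‖A‖ :=
      fun c A => (isTraceClass_smul c A.isTraceClass).2
    refine le_antisymm (hle c A) ?_
    by_cases hc : c = 0
    · rw [hc, norm_zero, zero_mul]; exact traceNorm_nonneg _
    have h := hle c⁻¹ (c • A)
    rw [smul_smul, inv_mul_cancel₀ hc, one_smul, norm_inv] at h
    have hc' : 0 < ‖c‖ := norm_pos_iff.2 hc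
    rwa [inv_mul_eq_div, le_div_iff₀ hc', mul_comm] at h
  norm_triangle A B := (isTraceClass_add A.isTraceClass B.isTraceClass).2
  norm_eq_zero_iff A := by
    constructor
    · intro h
      have h1 := norm_op_le A
      rw [h] at h1
      exact ext (norm_le_zero_iff.1 h1)
    · intro h
      have h1 := (isTraceClass_of_bound (A := (0 : H →L[ℂ] H)) (C := 0) fun W _ s => by simp).2
      rw [h]
      exact le_antisymm h1 (traceNorm_nonneg _)

noncomputable instance : NormedAddCommGroup (SATraceClass H) := NormedAddCommGroup.ofCore core

noncomputable instance : NormedSpace ℝ (SATraceClass H) := NormedSpace.ofCore core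

/-- `𝔗_s` is a Banach space. -/
instance : CompleteSpace (SATraceClass H) := by
  refine Metric.complete_of_cauchySeq_tendsto fun a ha => ?_
  have hop : CauchySeq fun n => (a n).op := by
    rw [Metric.cauchySeq_iff] at ha ⊢
    intro ε hε
    obtain ⟨N, hN⟩ := ha ε hε
    refine ⟨N, fun m hm n hn => lt_of_le_of_lt ?_ (hN m hm n hn)⟩
    rw [dist_eq_norm, dist_eq_norm]
    exact norm_op_le (a m - a n)
  obtain ⟨A, hA⟩ := cauchySeq_tendsto_of_complete hop
  have hsa : IsSelfAdjoint A := by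
    have h1 : Filter.Tendsto (fun n => star (a n).op) Filter.atTop (𝓝 (star A)) :=
      (continuous_star.tendsto A).comp hA
    have h2 : (fun n => star (a n).op) = fun n => (a n).op :=
      funext fun n => (a n).isSelfAdjoint.star_eq
    rw [h2] at h1
    exact tendsto_nhds_unique h1 hA
  have key : ∀ ε > 0, ∃ N, ∀ n ≥ N, IsTraceClass ((a n).op - A) ∧ traceNorm ((a n).op - A) ≤ ε := by
    intro ε hε
    obtain ⟨N, hN⟩ := Metric.cauchySeq_iff.1 ha ε hε
    refine ⟨N, fun n hn => isTraceClass_of_bound fun W hW s => ?_⟩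
    have hlim : Filter.Tendsto
        (fun m => ∑ i ∈ s, ‖⟪W (onb H i), ((a n).op - (a m).op) (onb H i)⟫_ℂ‖) Filter.atTop
        (𝓝 (∑ i ∈ s, ‖⟪W (onb H i), ((a n).op - A) (onb H i)⟫_ℂ‖)) := by
      refine tendsto_finsetSum s fun i _ => ?_
      have hc : Continuous fun T : H →L[ℂ] H => ‖⟪W (onb H i), ((a n).op - T) (onb H i)⟫_ℂ‖ := by
        fun_prop
      exact (hc.tendsto A).comp hA
    refine le_of_tendsto hlim (Filter.eventually_atTop.2 ⟨N, fun m hm => ?_⟩)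
    have h1 := hN n hn m hm
    rw [dist_eq_norm] at h1
    exact (sum_inner_le (a n - a m).isTraceClass hW (onb H).orthonormal s).trans h1.le
  have hT : IsTraceClass A := by
    obtain ⟨N, hN⟩ := key 1 one_pos
    have h1 := (isTraceClass_smul (-1) (hN N le_rfl).1).1
    have h2 := (isTraceClass_add (a N).isTraceClass h1).1
    have h3 : (a N).op + (-1 : ℝ) • ((a N).op - A) = A := by
      rw [neg_one_smul]; abel
    rwa [h3] at h2
  refine ⟨mk A hsa hT, Metric.tendsto_atTop.2 fun ε hε => ?_⟩
  obtain ⟨N, hN⟩ := key (ε / 2) (half_pos hε)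
  refine ⟨N, fun n hn => ?_⟩
  rw [dist_eq_norm]
  exact lt_of_le_of_lt (hN n hn).2 (half_lt_self hε)

/-- A self-adjoint operator of finite rank as an element of `𝔗_s`. -/
def ofFiniteRank (A : H →L[ℂ] H) (hA : IsSelfAdjoint A) (hfin : FiniteDimensional ℂ A.range) :
    SATraceClass H :=
  mk A hA (isTraceClass_of_finiteRank hfin)

/-- The action `u • A = u A u*` of the unitary group of `H` on `𝔗_s`. -/
noncomputable instance : MulAction (unitary (H →L[ℂ] H)) (SATraceClass H) where
  smul u A := mk ((u : H →L[ℂ] H) * A.op * star (u : H →L[ℂ] H)) (A.isSelfAdjoint.conjugate _)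
    (isTraceClass_conj u A.isTraceClass).1
  one_smul A := by
    apply ext
    change ((1 : unitary (H →L[ℂ] H)) : H →L[ℂ] H) * A.op * star _ = A.op
    simp
  mul_smul u v A := by
    apply ext
    change ((u * v : unitary (H →L[ℂ] H)) : H →L[ℂ] H) * A.op * star _
      = (u : H →L[ℂ] H) * ((v : H →L[ℂ] H) * A.op * star (v : H →L[ℂ] H)) * star (u : H →L[ℂ] H)
    simp [mul_assoc]

theorem op_unitary_smul (u : unitary (H →L[ℂ] H)) (A : SATraceClass H) :
    (u • A).op = (u : H →L[ℂ] H) * A.op * star (u : H →L[ℂ] H) := rfl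

end SATraceClass

end Space

section Cayley

variable {A : Type u} [CStarAlgebra A]

/-- The inverse of the Cayley transform, `a ↦ (i - a)(i + a)⁻¹`, as a map of the algebra. -/
noncomputable def invCayley (a : A) : A :=
  (Complex.I • (1 : A) - a) * Ring.inverse (Complex.I • (1 : A) + a)

/-- The Cayley transform `w ↦ i(1 - w)(1 + w)⁻¹`, as a map of the algebra. -/
noncomputable def cayley (w : A) : A :=
  Complex.I • ((1 - w) * Ring.inverse (1 + w))

theorem commute_inverse {x y : A} (h : Commute x y) (hy : IsUnit y) :
    Commute x (Ring.inverse y) := by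
  obtain ⟨v, rfl⟩ := hy
  rw [Ring.inverse_unit]
  exact h.units_inv_right

theorem isUnit_I_add {a : A} (ha : IsSelfAdjoint a) : IsUnit (Complex.I • (1 : A) + a) := by
  have h : (-Complex.I) ∉ spectrum ℂ a := by
    intro h
    have := ha.im_eq_zero_of_mem_spectrum h
    simp at this
  rw [spectrum.notMem_iff, Algebra.algebraMap_eq_smul_one] at h
  have h2 : (-Complex.I) • (1 : A) - a = -(Complex.I • (1 : A) + a) := by
    rw [neg_smul]; abel
  rw [h2] at h
  simpa using h.neg

theorem isUnit_I_sub {a : A} (ha : IsSelfAdjoint a) : IsUnit (Complex.I • (1 : A) - a) := by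
  have := isUnit_I_add ha.neg
  rwa [← sub_eq_add_neg] at this

theorem one_add_invCayley {a : A} (ha : IsSelfAdjoint a) :
    1 + invCayley a = (2 * Complex.I) • Ring.inverse (Complex.I • (1 : A) + a) := by
  have h := Ring.mul_inverse_cancel _ (isUnit_I_add ha)
  calc 1 + invCayley a
      = (Complex.I • (1 : A) + a) * Ring.inverse (Complex.I • (1 : A) + a) + invCayley a := by rw [h]
    _ = ((Complex.I • (1 : A) + a) + (Complex.I • (1 : A) - a))
          * Ring.inverse (Complex.I • (1 : A) + a) := by rw [invCayley, ← add_mul]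
    _ = _ := by
      rw [add_add_sub_cancel, ← add_smul, ← two_mul, smul_mul_assoc, one_mul]

theorem one_sub_invCayley {a : A} (ha : IsSelfAdjoint a) :
    1 - invCayley a = (2 : ℂ) • (a * Ring.inverse (Complex.I • (1 : A) + a)) := by
  have h := Ring.mul_inverse_cancel _ (isUnit_I_add ha)
  calc 1 - invCayley a
      = (Complex.I • (1 : A) + a) * Ring.inverse (Complex.I • (1 : A) + a) - invCayley a := by rw [h]
    _ = ((Complex.I • (1 : A) + a) - (Complex.I • (1 : A) - a))
          * Ring.inverse (Complex.I • (1 : A) + a) := by rw [invCayley, ← sub_mul]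
    _ = _ := by
      rw [add_sub_sub_cancel, ← two_smul ℂ a, smul_mul_assoc]

theorem isUnit_one_add_invCayley {a : A} (ha : IsSelfAdjoint a) : IsUnit (1 + invCayley a) := by
  rw [one_add_invCayley ha]
  have h1 : IsUnit (Ring.inverse (Complex.I • (1 : A) + a)) := (isUnit_I_add ha).ringInverse
  have h2 : IsUnit (2 * Complex.I) := by simp
  obtain ⟨c, hc⟩ := h2
  rw [← hc]
  exact h1.smul c

theorem cayley_invCayley {a : A} (ha : IsSelfAdjoint a) : cayley (invCayley a) = a := by
  have h := isUnit_one_add_invCayley ha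
  have h1 : cayley (invCayley a) * (1 + invCayley a) = a * (1 + invCayley a) := by
    rw [cayley, smul_mul_assoc, mul_assoc, Ring.inverse_mul_cancel _ h, mul_one,
      one_sub_invCayley ha, one_add_invCayley ha, smul_smul, mul_smul_comm, mul_comm Complex.I]
  exact h.mul_right_cancel h1

theorem invCayley_mem_unitary {a : A} (ha : IsSelfAdjoint a) : invCayley a ∈ unitary A := by
  have hp := isUnit_I_add ha
  have hm := isUnit_I_sub ha
  have hstar : star (invCayley a)
      = Ring.inverse (Complex.I • (1 : A) - a) * (Complex.I • (1 : A) + a) := by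
    have e1 : star (Complex.I • (1 : A) - a) = -(Complex.I • (1 : A) + a) := by
      rw [star_sub, star_smul, star_one, ha.star_eq]; simp only [RCLike.star_def, Complex.conj_I, neg_smul]; abel
    have e2 : star (Complex.I • (1 : A) + a) = -(Complex.I • (1 : A) - a) := by
      rw [star_add, star_smul, star_one, ha.star_eq]; simp only [RCLike.star_def, Complex.conj_I, neg_smul]; abel
    rw [invCayley, star_mul, e1, ← Ring.inverse_star, e2]
    have e3 : Ring.inverse (-(Complex.I • (1 : A) - a)) = -Ring.inverse (Complex.I • (1 : A) - a) := by
      apply hm.neg.mul_left_cancel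
      rw [Ring.mul_inverse_cancel _ hm.neg, neg_mul_neg, Ring.mul_inverse_cancel _ hm]
    rw [e3, neg_mul_neg]
  have hcomm : (Complex.I • (1 : A) - a) * (Complex.I • (1 : A) + a)
      = (Complex.I • (1 : A) + a) * (Complex.I • (1 : A) - a) := by
    have hc : Commute (Complex.I • (1 : A)) a := (Commute.one_left a).smul_left _
    exact (((Commute.refl _).add_right hc).sub_left (hc.symm.add_right (Commute.refl a))).eq
  rw [Unitary.mem_iff, hstar, invCayley]
  constructor
  · calc _ = Ring.inverse (Complex.I • (1 : A) - a) * ((Complex.I • (1 : A) + a)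
          * (Complex.I • (1 : A) - a)) * Ring.inverse (Complex.I • (1 : A) + a) := by
            simp only [mul_assoc]
      _ = Ring.inverse (Complex.I • (1 : A) - a) * (Complex.I • (1 : A) - a)
          * ((Complex.I • (1 : A) + a) * Ring.inverse (Complex.I • (1 : A) + a)) := by
            rw [← hcomm]; simp only [mul_assoc]
      _ = 1 := by rw [Ring.inverse_mul_cancel _ hm, Ring.mul_inverse_cancel _ hp, one_mul]
  · have h1 : Ring.inverse (Complex.I • (1 : A) + a) * Ring.inverse (Complex.I • (1 : A) - a)
        = Ring.inverse (Complex.I • (1 : A) - a) * Ring.inverse (Complex.I • (1 : A) + a) := by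
      have hc : Commute (Complex.I • (1 : A) - a) (Complex.I • (1 : A) + a) := hcomm
      exact (hc.ringInverse_ringInverse).symm.eq
    calc _ = (Complex.I • (1 : A) - a) * (Ring.inverse (Complex.I • (1 : A) + a)
          * Ring.inverse (Complex.I • (1 : A) - a)) * (Complex.I • (1 : A) + a) := by
            simp only [mul_assoc]
      _ = ((Complex.I • (1 : A) - a) * Ring.inverse (Complex.I • (1 : A) - a))
          * (Ring.inverse (Complex.I • (1 : A) + a) * (Complex.I • (1 : A) + a)) := by
            rw [h1]; simp only [mul_assoc]
      _ = 1 := by rw [Ring.inverse_mul_cancel _ hp, Ring.mul_inverse_cancel _ hm, one_mul]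

theorem isSelfAdjoint_cayley {w : A} (hw : w ∈ unitary A) : IsSelfAdjoint (cayley w) := by
  by_cases h : IsUnit (1 + w)
  · have hs : IsUnit (star (1 + w)) := h.star
    have hsw : star w * w = 1 := Unitary.star_mul_self_of_mem hw
    have e1 : star (1 + w) * w = 1 + w := by
      rw [star_add, star_one, add_mul, one_mul, hsw, add_comm]
    have e2 : star (1 - w) * w = -(1 - w) := by
      rw [star_sub, star_one, sub_mul, one_mul, hsw]; abel
    have hc : Commute (1 - w) (Ring.inverse (1 + w)) := by
      have : Commute (1 - w) (1 + w) :=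
        ((Commute.one_left _).sub_left ((Commute.one_right w).add_right (Commute.refl w)))
      exact commute_inverse this h
    have hinv : Ring.inverse (star (1 + w)) = w * Ring.inverse (1 + w) := by
      apply hs.mul_left_cancel
      rw [Ring.mul_inverse_cancel _ hs, ← mul_assoc, e1, Ring.mul_inverse_cancel _ h]
    have hcw : Commute w (Ring.inverse (1 + w)) := by
      have : Commute w (1 + w) := (Commute.one_right w).add_right (Commute.refl w)
      exact commute_inverse this h
    have e3 : w * star (1 - w) = -(1 - w) := by
      have : w * star w = 1 := Unitary.mul_star_self_of_mem hw
      rw [star_sub, star_one, mul_sub, mul_one, this]; abel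
    rw [isSelfAdjoint_iff, cayley, star_smul, star_mul, ← Ring.inverse_star, hinv, hcw.eq,
      mul_assoc, e3, mul_neg, smul_neg, hc.eq]
    simp
  · rw [cayley, Ring.inverse_non_unit _ h, mul_zero, smul_zero]
    exact IsSelfAdjoint.zero _

theorem invCayley_cayley {w : A} (hw : w ∈ unitary A) (h : IsUnit (1 + w)) :
    invCayley (cayley w) = w := by
  have hp := isUnit_I_add (isSelfAdjoint_cayley hw)
  have hi := Ring.inverse_mul_cancel _ h
  have hcw : cayley w * (1 + w) = Complex.I • (1 - w) := by
    rw [cayley, smul_mul_assoc, mul_assoc, hi, mul_one]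
  have h1 : (Complex.I • (1 : A) + cayley w) * (1 + w) = (2 * Complex.I) • (1 : A) := by
    rw [add_mul, hcw, smul_mul_assoc, one_mul, ← smul_add, add_add_sub_cancel, mul_comm, mul_smul,
      two_smul]
  have h2 : (Complex.I • (1 : A) - cayley w) * (1 + w) = (2 * Complex.I) • w := by
    rw [sub_mul, hcw, smul_mul_assoc, one_mul, ← smul_sub, add_sub_sub_cancel, mul_comm, mul_smul,
      two_smul]
  have hc : Commute (Complex.I • (1 : A) - cayley w) (Ring.inverse (Complex.I • (1 : A) + cayley w)) := by
    have hc0 : Commute (Complex.I • (1 : A)) (cayley w) := (Commute.one_left _).smul_left _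
    exact commute_inverse
      (((Commute.refl _).add_right hc0).sub_left (hc0.symm.add_right (Commute.refl _))) hp
  have h3 : (2 * Complex.I) • (Ring.inverse (Complex.I • (1 : A) + cayley w)) = 1 + w := by
    apply hp.mul_left_cancel
    rw [h1, mul_smul_comm, Ring.mul_inverse_cancel _ hp]
  have h4 : (2 * Complex.I) • invCayley (cayley w) = (2 * Complex.I) • w := by
    rw [invCayley, ← mul_smul_comm, h3, h2]
  have h5 : (2 * Complex.I : ℂ) ≠ 0 := by simp
  exact smul_right_injective A h5 h4

theorem continuousAt_inverse {x : A} (hx : IsUnit x) : ContinuousAt (Ring.inverse : A → A) x := by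
  obtain ⟨v, rfl⟩ := hx
  exact NormedRing.inverse_continuousAt v

/-- The chart of the unitary group centred at `u₀`: the Cayley transform `u ↦ i(1 - w)(1 + w)⁻¹`,
`w = u₀* u`, from the open set of all `u` for which `1 + w` is invertible onto the space of all
self-adjoint elements. -/
noncomputable def cayleyChart (u₀ : unitary A) :
    OpenPartialHomeomorph (unitary A) (selfAdjoint A) where
  toFun u := ⟨cayley ((u₀⁻¹ * u : unitary A) : A), isSelfAdjoint_cayley (u₀⁻¹ * u).2⟩
  invFun a := u₀ * ⟨invCayley (a : A), invCayley_mem_unitary a.2⟩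
  source := {u | IsUnit (1 + ((u₀⁻¹ * u : unitary A) : A))}
  target := Set.univ
  map_source' _ _ := Set.mem_univ _
  map_target' a _ := by
    change IsUnit (1 + ((u₀⁻¹ * (u₀ * ⟨invCayley (a : A), invCayley_mem_unitary a.2⟩) :
      unitary A) : A))
    rw [inv_mul_cancel_left]
    exact isUnit_one_add_invCayley a.2
  left_inv' u hu := by
    have h : (⟨invCayley (cayley ((u₀⁻¹ * u : unitary A) : A)),
        invCayley_mem_unitary (isSelfAdjoint_cayley (u₀⁻¹ * u).2)⟩ : unitary A) = u₀⁻¹ * u :=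
      Subtype.ext (invCayley_cayley (u₀⁻¹ * u).2 hu)
    simp only [h, mul_inv_cancel_left]
  right_inv' a _ := by
    apply Subtype.ext
    simp only [inv_mul_cancel_left]
    exact cayley_invCayley a.2
  open_source := by
    have h : Continuous fun u : unitary A => 1 + ((u₀⁻¹ * u : unitary A) : A) := by fun_prop
    exact Units.isOpen.preimage h
  open_target := isOpen_univ
  continuousOn_toFun := by
    refine continuousOn_iff_continuous_domRestrict.2 (Continuous.subtype_mk ?_ _)
    rw [continuous_iff_continuousAt]
    rintro ⟨u, hu⟩
    have h : Continuous fun u : {u : unitary A | IsUnit (1 + ((u₀⁻¹ * u : unitary A) : A))} =>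
        ((u₀⁻¹ * u.1 : unitary A) : A) := by fun_prop
    have h1 := h.continuousAt (x := ⟨u, hu⟩)
    have h2 : ContinuousAt (fun w : A => Ring.inverse (1 + w)) ((u₀⁻¹ * u : unitary A) : A) :=
      (continuousAt_inverse hu).comp (f := fun w : A => 1 + w) (by fun_prop)
    have h3 : ContinuousAt (cayley : A → A) ((u₀⁻¹ * u : unitary A) : A) :=
      ((continuousAt_const.sub continuousAt_id).mul h2).const_smul _
    exact h3.comp (f := fun u : {u : unitary A | IsUnit (1 + ((u₀⁻¹ * u : unitary A) : A))} =>
        ((u₀⁻¹ * u.1 : unitary A) : A)) h1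
  continuousOn_invFun := by
    refine Continuous.continuousOn (continuous_const.mul (Continuous.subtype_mk ?_ _))
    rw [continuous_iff_continuousAt]
    intro a
    have h2 : ContinuousAt (fun a : selfAdjoint A => Ring.inverse (Complex.I • (1 : A) + (a : A))) a :=
      (continuousAt_inverse (isUnit_I_add a.2)).comp
        (f := fun a : selfAdjoint A => Complex.I • (1 : A) + (a : A)) (by fun_prop)
    exact (continuousAt_const.sub continuous_subtype_val.continuousAt).mul h2

theorem mem_cayleyChart_source (u : unitary A) : u ∈ (cayleyChart u).source := by
  have h : (1 : A) + 1 = (2 : ℂ) • (1 : A) := by rw [two_smul]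
  have h2 : IsUnit ((2 : ℂ) • (1 : A)) := by
    simpa [Algebra.algebraMap_eq_smul_one] using
      (IsUnit.mk0 (2 : ℂ) two_ne_zero).map (algebraMap ℂ A)
  change IsUnit (1 + ((u⁻¹ * u : unitary A) : A))
  rw [inv_mul_cancel, OneMemClass.coe_one, h]
  exact h2

/-- The standard Banach manifold structure of the unitary group, modelled on the real Banach space
of self-adjoint elements, with atlas the Cayley charts. -/
noncomputable instance : ChartedSpace (selfAdjoint A) (unitary A) where
  atlas := Set.range cayleyChart
  chartAt := cayleyChart
  mem_chart_source := mem_cayleyChart_source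
  chart_mem_atlas u := ⟨u, rfl⟩

theorem contDiffAt_inverse {x : A} (hx : IsUnit x) :
    ContDiffAt ℝ ω (Ring.inverse : A → A) x := by
  obtain ⟨v, rfl⟩ := hx
  exact contDiffAt_ringInverse ℝ v

/-- The unitary group is a real-analytic Banach manifold. -/
instance : IsManifold 𝓘(ℝ, selfAdjoint A) ω (unitary A) := by
  refine isManifold_of_contDiffOn _ _ _ ?_
  rintro _ _ ⟨u, rfl⟩ ⟨v, rfl⟩
  simp only [modelWithCornersSelf_coe, modelWithCornersSelf_coe_symm, Function.comp_id,
    Function.id_comp, Set.preimage_id, Set.range_id, Set.inter_univ]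
  intro a ha
  have hunit : IsUnit (1 + ((v⁻¹ * u : unitary A) : A) * invCayley (a : A)) := by
    have h1 : (cayleyChart u).symm a ∈ (cayleyChart v).source := by
      rw [OpenPartialHomeomorph.trans_source] at ha
      exact ha.2
    have h2 : IsUnit (1 + ((v⁻¹ * (u * ⟨invCayley (a : A), invCayley_mem_unitary a.2⟩) :
      unitary A) : A)) := h1
    rwa [← mul_assoc] at h2
  have hval : ContDiff ℝ ω (fun b : selfAdjoint A => (b : A)) :=
    (selfAdjoint.submodule ℝ A).subtypeL.contDiff
  have hinv : ContDiffAt ℝ ω (fun b : selfAdjoint A => invCayley (b : A)) a := by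
    have h1 : ContDiffAt ℝ ω (fun b : selfAdjoint A => Complex.I • (1 : A) + (b : A)) a :=
      contDiffAt_const.add hval.contDiffAt
    have h2 : ContDiffAt ℝ ω (fun b : selfAdjoint A => Ring.inverse (Complex.I • (1 : A) + (b : A))) a :=
      ContDiffAt.comp (g := (Ring.inverse : A → A)) a (contDiffAt_inverse (isUnit_I_add a.2)) h1
    exact (contDiffAt_const.sub hval.contDiffAt).mul h2
  have hmul : ContDiffAt ℝ ω
      (fun b : selfAdjoint A => ((v⁻¹ * u : unitary A) : A) * invCayley (b : A)) a :=
    contDiffAt_const.mul hinv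
  have hcay : ContDiffAt ℝ ω
      (fun b : selfAdjoint A => cayley (((v⁻¹ * u : unitary A) : A) * invCayley (b : A))) a := by
    have h1 : ContDiffAt ℝ ω (fun b : selfAdjoint A =>
        Ring.inverse (1 + ((v⁻¹ * u : unitary A) : A) * invCayley (b : A))) a :=
      ContDiffAt.comp (g := (Ring.inverse : A → A)) a (contDiffAt_inverse hunit)
        (contDiffAt_const.add hmul)
    exact ((contDiffAt_const.sub hmul).mul h1).const_smul Complex.I
  have hproj : ContDiffAt ℝ ω (fun b : selfAdjoint A => selfAdjointPartL ℝ A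
      (cayley (((v⁻¹ * u : unitary A) : A) * invCayley (b : A)))) a :=
    (selfAdjointPartL ℝ A).contDiff.contDiffAt.comp a hcay
  refine (hproj.congr_of_eventuallyEq (Filter.Eventually.of_forall fun b => ?_)).contDiffWithinAt
  have h1 : ((cayleyChart v ((cayleyChart u).symm b) : selfAdjoint A) : A)
      = cayley (((v⁻¹ * u : unitary A) : A) * invCayley (b : A)) := by
    change cayley ((v⁻¹ * (u * ⟨invCayley (b : A), invCayley_mem_unitary b.2⟩) : unitary A) : A) = _
    rw [← mul_assoc]; rfl
  apply Subtype.ext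
  change ((cayleyChart v ((cayleyChart u).symm b) : selfAdjoint A) : A) = _
  have h2 := (cayleyChart v ((cayleyChart u).symm b)).2
  change _ = ((selfAdjointPart ℝ (cayley (((v⁻¹ * u : unitary A) : A) * invCayley (b : A))) :
    selfAdjoint A) : A)
  rw [← h1]
  exact h2.coe_selfAdjointPart_apply ℝ |>.symm

end Cayley

section Submanifold

/-- `S` is a (split) real-analytic submanifold of the real Banach space `E`: around each of its
points there is an analytic chart of `E` with values in a product `F × G` of Banach spaces which
straightens `S` to the slice `F × {0}`. -/
def IsAnalyticSubmanifold {E : Type u} [NormedAddCommGroup E] [NormedSpace ℝ E] (S : Set E) : Prop :=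
  ∀ x ∈ S, ∃ (F : Type u) (_ : NormedAddCommGroup F) (_ : NormedSpace ℝ F) (_ : CompleteSpace F)
    (G : Type u) (_ : NormedAddCommGroup G) (_ : NormedSpace ℝ G) (_ : CompleteSpace G)
    (φ : OpenPartialHomeomorph E (F × G)), x ∈ φ.source ∧
      ContDiffOn ℝ ω φ φ.source ∧ ContDiffOn ℝ ω φ.symm φ.target ∧
      ∀ y ∈ φ.source, y ∈ S ↔ (φ y).2 = 0

end Submanifold

end UnitaryOrbit

/-!
The orbit of `ρ` under the unitary group is treated in an abstract setting: a C*-algebra `A`, and a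
Banach space `T` of self-adjoint elements of `A` on which the unitary group acts by conjugation
(`ConjugationModel`). The trace class is an instance because it is a two-sided ideal with
`‖aB‖₁, ‖Ba‖₁ ≤ ‖a‖ ‖B‖₁`. The only property of `ρ` that matters is that its spectrum is finite.

Finiteness of the spectrum enters twice. It makes the commutator map `D b = bρ - ρb` split: dividing
the blocks of `b` by the differences of the eigenvalues gives a bounded quasi-inverse `K` of `D`
(`exists_commutator_quasiInverse`). The idempotent `K D` splits the self-adjoint elements into the
tangent directions of the orbit and the isotropy algebra, and `D K` splits `T` into the tangent space
of the orbit and the elements commuting with `ρ` (`exists_splittings`); both splittings have the same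
first summand `E`. It also makes the orbit rigid: an element near `ρ` which commutes with `ρ` and has
its spectrum inside that of `ρ` is equal to `ρ` (`eq_of_commute_of_isUnit_intertwiner`), because
`∑ p(b) p(ρ)`, summed over the Lagrange polynomials of the spectrum, intertwines `b` and `ρ` and is
invertible for `b` near `ρ`.

By the inverse function theorem, `(x, y) ↦ c(x) (ρ + y) c(x)*` is an analytic local diffeomorphism,
where `x` is a tangent direction, `c` the inverse Cayley transform, and `y` commutes with `ρ`. By
rigidity, the orbit is the slice `y = 0` in these coordinates (`exists_orbitSlice`). Everything else
is read off from this chart and its translates: points of the orbit near `ρ` have the form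
`c(x) ρ c(x)*` with `c(x)` near `1`; the first component is a chart of the homogeneous space, and since
it extends to an open set of `T`, the inclusion is a topological embedding. In these charts the
inclusion is `x ↦ (x, 0)`. The projection of the unitary group is `(x, k) ↦ x` in the coordinates
given by `c(x) c(k)` with `k` in the isotropy algebra (`exists_factorization_chart`), as the factor
`c(k)` fixes `ρ`.
-/

namespace UnitaryOrbit

/-! ### Schur multipliers of a finite spectral decomposition -/

section Spectral

open Polynomial

variable {A : Type u} [CStarAlgebra A]

theorem aeval_eq_of_eqOn_spectrum {a : A} (ha : IsSelfAdjoint a) {p q : ℝ[X]}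
    (h : (spectrum ℝ a).EqOn p.eval q.eval) : aeval a p = aeval a q := by
  rw [← cfc_polynomial p a ha, ← cfc_polynomial q a ha]
  exact cfc_congr h

theorem isSelfAdjoint_aeval {a : A} (ha : IsSelfAdjoint a) (p : ℝ[X]) :
    IsSelfAdjoint (aeval a p) := by
  rw [← cfc_polynomial p a ha]
  exact cfc_predicate _ a

/-- The spectral projection of a self-adjoint element with spectrum contained in the finite set `s`
for the eigenvalue `c`, as a Lagrange polynomial in the element. Being polynomial, it is defined
and continuous on the whole algebra. -/
noncomputable def specProj (s : Finset ℝ) (a : A) (c : s) : A :=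
  aeval a (Lagrange.basis s id (c : ℝ))

theorem continuous_specProj (s : Finset ℝ) (c : s) : Continuous fun a : A => specProj s a c :=
  Polynomial.continuous_aeval _

theorem eval_basis {s : Finset ℝ} (c : s) {x : ℝ} (hx : x ∈ s) :
    (Lagrange.basis s id (c : ℝ)).eval x = if x = c then 1 else 0 := by
  split_ifs with h
  · rw [h]; exact Lagrange.eval_basis_self Function.injective_id.injOn c.2
  · exact Lagrange.eval_basis_of_ne (v := id) (Ne.symm h) hx

variable {s : Finset ℝ} {a : A}

theorem sum_specProj (hs : s.Nonempty) : ∑ c : s, specProj s a c = 1 := by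
  have h := Lagrange.sum_basis (s := s) (v := id) Function.injective_id.injOn hs
  have h2 := congrArg (aeval a) h
  rw [map_sum, map_one, ← Finset.sum_coe_sort] at h2
  exact h2

theorem specProj_mul (ha : IsSelfAdjoint a) (hs : spectrum ℝ a ⊆ s) (c d : s) :
    specProj s a c * specProj s a d = if c = d then specProj s a c else 0 := by
  rw [specProj, specProj, ← map_mul]
  split_ifs with h
  · subst h
    refine aeval_eq_of_eqOn_spectrum ha fun x hx => ?_
    simp only [eval_mul, eval_basis _ (hs hx)]
    split_ifs <;> simp
  · rw [← map_zero (aeval (R := ℝ) a)]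
    refine aeval_eq_of_eqOn_spectrum ha fun x hx => ?_
    simp only [eval_mul, eval_basis _ (hs hx), eval_zero]
    split_ifs with h1 h2
    · exact absurd (Subtype.ext (h1.symm.trans h2)) h
    all_goals simp

theorem mul_specProj (ha : IsSelfAdjoint a) (hs : spectrum ℝ a ⊆ s) (c : s) :
    a * specProj s a c = (c : ℝ) • specProj s a c := by
  have h : aeval a (X * Lagrange.basis s id (c : ℝ)) = aeval a (C (c : ℝ) * Lagrange.basis s id c) :=
    aeval_eq_of_eqOn_spectrum ha fun x hx => by
      simp only [eval_mul, eval_X, eval_C, eval_basis _ (hs hx)]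
      split_ifs with h <;> simp [h]
  simpa [specProj, Algebra.smul_def] using h

theorem specProj_commute (b : A) (h : Commute b a) (c : s) : Commute b (specProj s a c) := by
  rw [specProj, aeval_eq_sum_range]
  exact Commute.sum_right _ _ _ fun i _ => (h.pow_right i).smul_right _

theorem specProj_mul_self (ha : IsSelfAdjoint a) (hs : spectrum ℝ a ⊆ s) (c : s) :
    specProj s a c * a = (c : ℝ) • specProj s a c := by
  rw [← mul_specProj ha hs, (specProj_commute a (Commute.refl a) c).eq]

/-- The Schur multiplier `b ↦ ∑ m(j,k) Pⱼ b Pₖ` with respect to the spectral projections of `a`. -/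
noncomputable def schur (s : Finset ℝ) (a : A) (m : s → s → ℝ) : A →L[ℂ] A :=
  ∑ j : s, ∑ k : s, (m j k : ℂ) • ((ContinuousLinearMap.mul ℂ A (specProj s a j)).comp
    ((ContinuousLinearMap.mul ℂ A).flip (specProj s a k)))

theorem schur_apply (m : s → s → ℝ) (b : A) :
    schur s a m b = ∑ j : s, ∑ k : s, (m j k : ℂ) • (specProj s a j * (b * specProj s a k)) := by
  simp [schur]

theorem specProj_schur (ha : IsSelfAdjoint a) (hs : spectrum ℝ a ⊆ s) (m : s → s → ℝ) (b : A)
    (j k : s) : specProj s a j * (schur s a m b * specProj s a k)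
      = (m j k : ℂ) • (specProj s a j * (b * specProj s a k)) := by
  rw [schur_apply]
  simp only [Finset.sum_mul, Finset.mul_sum, smul_mul_assoc, mul_smul_comm]
  rw [Finset.sum_eq_single j, Finset.sum_eq_single k]
  · rw [← mul_assoc, ← mul_assoc, specProj_mul ha hs, if_pos rfl, mul_assoc, mul_assoc,
      specProj_mul ha hs, if_pos rfl]
  · intro l _ hl
    rw [mul_assoc, mul_assoc, specProj_mul ha hs, if_neg hl]; simp
  · exact fun h => absurd (Finset.mem_univ _) h
  · intro l _ hl
    refine Finset.sum_eq_zero fun k' _ => ?_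
    rw [← mul_assoc, ← mul_assoc, specProj_mul ha hs, if_neg hl.symm]; simp
  · exact fun h => absurd (Finset.mem_univ _) h

theorem schur_schur (ha : IsSelfAdjoint a) (hs : spectrum ℝ a ⊆ s) (m n : s → s → ℝ) (b : A) :
    schur s a m (schur s a n b) = schur s a (m * n) b := by
  rw [schur_apply m, schur_apply (m * n)]
  simp only [specProj_schur ha hs, smul_smul, Pi.mul_apply, Complex.ofReal_mul]

theorem schur_sub (m n : s → s → ℝ) (b : A) :
    schur s a (m - n) b = schur s a m b - schur s a n b := by
  simp [schur_apply, sub_smul, Finset.sum_sub_distrib]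

theorem star_schur (ha : IsSelfAdjoint a) (m : s → s → ℝ) (b : A) :
    star (schur s a m b) = schur s a (fun j k => m k j) (star b) := by
  rw [schur_apply, schur_apply, Finset.sum_comm]
  have hsp : ∀ j : s, star (specProj s a j) = specProj s a j := fun j =>
    (isSelfAdjoint_aeval ha _).star_eq
  simp [star_sum, hsp, mul_assoc]

/-- The commutator with `a` is a Schur multiplier. -/
theorem schur_commutator (ha : IsSelfAdjoint a) (hs : spectrum ℝ a ⊆ s) (hne : s.Nonempty) (b : A) :
    schur s a (fun j k => (k : ℝ) - j) b = b * a - a * b := by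
  have h1 : ∀ b : A, b = ∑ j : s, ∑ k : s, specProj s a j * (b * specProj s a k) := by
    intro b
    simp only [← Finset.mul_sum, ← Finset.sum_mul, sum_specProj hne, one_mul, mul_one]
  rw [schur_apply, h1 (b * a - a * b)]
  refine Finset.sum_congr rfl fun j _ => Finset.sum_congr rfl fun k _ => ?_
  have e1 : specProj s a j * ((b * a - a * b) * specProj s a k)
      = specProj s a j * (b * (a * specProj s a k)) - (specProj s a j * a) * (b * specProj s a k) := by
    simp only [sub_mul, mul_sub, mul_assoc]
  rw [e1, mul_specProj ha hs, specProj_mul_self ha hs, mul_smul_comm, mul_smul_comm, smul_mul_assoc,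
    ← sub_smul, ← Complex.coe_smul]

/-- `K` is a quasi-inverse of the commutator map `D b = ba - ab`: `D (b - D (K b)) = 0` and
`K (D (K b)) = K b`. In addition it commutes with `D`, and it anticommutes with the involution, as
`D` does for self-adjoint `a`. -/
structure IsCommutatorQuasiInverse (a : A) (K : A →L[ℂ] A) : Prop where
  commute_sub : ∀ b, Commute (b - (K b * a - a * K b)) a
  map_commutator : ∀ b, K (b * a - a * b) = K b * a - a * K b
  map_map : ∀ b, K (K b * a - a * K b) = K b
  star_map : ∀ b, star (K b) = -K (star b)

/-- For finite spectrum, dividing the `(j, k)` block by the difference `k - j` of the eigenvalues,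
whenever it is not zero, gives a bounded quasi-inverse of the commutator. -/
theorem exists_commutator_quasiInverse (ha : IsSelfAdjoint a) (hs : spectrum ℝ a ⊆ s)
    (hne : s.Nonempty) :
    ∃ K : A →L[ℂ] A, IsCommutatorQuasiInverse a K := by
  refine ⟨schur s a fun j k => ((k : ℝ) - j)⁻¹, fun b => ?_, fun b => ?_, fun b => ?_, fun b => ?_⟩
  · refine sub_eq_zero.1 ?_
    rw [sub_mul, mul_sub, sub_sub_sub_comm]
    simp only [← schur_commutator ha hs hne, schur_schur ha hs, ← schur_sub]
    rw [schur_apply]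
    refine Finset.sum_eq_zero fun j _ => Finset.sum_eq_zero fun k _ => ?_
    simp only [Pi.sub_apply, Pi.mul_apply]
    by_cases h : (k : ℝ) - j = 0
    · simp [h]
    · rw [mul_inv_cancel₀ h, mul_one, sub_self, Complex.ofReal_zero, zero_smul]
  · simp only [← schur_commutator ha hs hne, schur_schur ha hs, mul_comm]
  · simp only [← schur_commutator ha hs hne, schur_schur ha hs]
    congr 2
    funext j k
    simp only [Pi.mul_apply]
    by_cases h : (k : ℝ) - j = 0
    · simp [h]
    · field_simp
  · rw [star_schur ha, ← sub_eq_zero, sub_neg_eq_add, schur_apply, schur_apply,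
      ← Finset.sum_add_distrib]
    refine Finset.sum_eq_zero fun j _ => ?_
    rw [← Finset.sum_add_distrib]
    refine Finset.sum_eq_zero fun k _ => ?_
    rw [← add_smul, ← Complex.ofReal_add, ← neg_sub (k : ℝ) (j : ℝ), inv_neg, neg_add_cancel]
    simp

/-- If `a` and `b` have spectrum in the finite set `s`, then `∑ p(b) p(a)`, `p` running through the
Lagrange polynomials of `s`, intertwines `a` and `b`. It equals `1` for `b = a`. -/
noncomputable def intertwiner (s : Finset ℝ) (a b : A) : A :=
  ∑ c : s, specProj s b c * specProj s a c

theorem continuous_intertwiner (s : Finset ℝ) (a : A) : Continuous (intertwiner s a) :=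
  continuous_finsetSum _ fun c _ => (continuous_specProj s c).mul continuous_const

theorem intertwiner_self (ha : IsSelfAdjoint a) (hs : spectrum ℝ a ⊆ s) (hne : s.Nonempty) :
    intertwiner s a a = 1 := by
  simp only [intertwiner, specProj_mul ha hs, if_true, sum_specProj hne]

/-- The spectrum isolates `a` among the nearby elements of its commutant. -/
theorem eq_of_commute_of_isUnit_intertwiner {b : A} (ha : IsSelfAdjoint a) (hs : spectrum ℝ a ⊆ s)
    (hb : IsSelfAdjoint b) (hsb : spectrum ℝ b ⊆ s) (hab : Commute b a)
    (h : IsUnit (intertwiner s a b)) : b = a := by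
  have h1 : b * intertwiner s a b = a * intertwiner s a b := by
    simp only [intertwiner, Finset.mul_sum]
    refine Finset.sum_congr rfl fun c _ => ?_
    rw [← mul_assoc, mul_specProj hb hsb, smul_mul_assoc, ← mul_assoc,
      (specProj_commute a hab.symm c).eq, mul_assoc, mul_specProj ha hs, mul_smul_comm]
  exact h.mul_right_cancel h1

end Spectral

/-! ### Analytic local inverses -/

section InverseFunction

/-- The inverse function theorem, with the local inverse analytic on its whole domain. -/
theorem exists_analytic_chart {E F : Type*} [NormedAddCommGroup E] [NormedSpace ℝ E]
    [CompleteSpace E] [NormedAddCommGroup F] [NormedSpace ℝ F] {f : E → F} {O : Set E} {x : E}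
    (hO : IsOpen O) (hx : x ∈ O) (hf : ∀ y ∈ O, ContDiffAt ℝ ω f y) (e : E ≃L[ℝ] F)
    (he : HasFDerivAt f (e : E →L[ℝ] F) x) :
    ∃ Θ : OpenPartialHomeomorph E F, x ∈ Θ.source ∧ Θ.source ⊆ O ∧ ⇑Θ = f ∧
      ContDiffOn ℝ ω f Θ.source ∧ ContDiffOn ℝ ω Θ.symm Θ.target := by
  have hfx := hf x hx
  have hcont : ContinuousAt (fderiv ℝ f) x := (hfx.fderiv_right (m := 0) (by simp)).continuousAt
  have hev : ∀ᶠ y in 𝓝 x, fderiv ℝ f y ∈ Set.range ((↑) : (E ≃L[ℝ] F) → E →L[ℝ] F) := by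
    refine hcont.eventually (ContinuousLinearEquiv.isOpen.mem_nhds ?_)
    exact ⟨e, he.fderiv.symm⟩
  obtain ⟨W, hW, hWo, hxW⟩ := eventually_nhds_iff.1 hev
  set Θ₀ := hfx.toOpenPartialHomeomorph f he (by simp) with hΘ₀
  have hcoe : ⇑Θ₀ = f := rfl
  set Θ := Θ₀.restrOpen (W ∩ O) (hWo.inter hO) with hΘ
  have hsrc : Θ.source = Θ₀.source ∩ (W ∩ O) := rfl
  refine ⟨Θ, ⟨hfx.mem_toOpenPartialHomeomorph_source he (by simp), hxW, hx⟩,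
    fun y hy => hy.2.2, rfl, fun y hy => (hf y hy.2.2).contDiffWithinAt, fun z hz => ?_⟩
  have hy : Θ.symm z ∈ Θ.source := Θ.map_target hz
  have hd := hf _ hy.2.2
  obtain ⟨e', he'⟩ := hW _ hy.2.1
  refine (Θ.contDiffAt_symm (f₀' := e') hz ?_ hd).contDiffWithinAt
  rw [he']
  exact (hd.differentiableAt (by simp)).hasFDerivAt

end InverseFunction

/-! ### The tangent space of the orbit and the isotropy algebra -/

section Splitting

variable {A : Type u} [CStarAlgebra A]

instance : CompleteSpace (selfAdjoint A) :=
  (isClosed_eq continuous_star continuous_id : IsClosed {x : A | star x = x}).completeSpace_coe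

/-- The self-adjoint elements fixed by the projection `b ↦ K (ba - ab)`. They parametrize the
tangent space at `a` of the unitary orbit of `a`. -/
def tangent (a : A) (K : A →L[ℂ] A) : Submodule ℝ (selfAdjoint A) where
  carrier := {x | K ((x : A) * a - a * x) = x}
  zero_mem' := by simp
  add_mem' {x y} hx hy := by
    have h : ((x + y : selfAdjoint A) : A) * a - a * (x + y : selfAdjoint A)
        = ((x : A) * a - a * x) + ((y : A) * a - a * y) := by
      rw [AddSubgroup.coe_add, add_mul, mul_add]; abel
    change K _ = _
    rw [h, map_add, hx, hy]; rfl
  smul_mem' c x hx := by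
    have h : ((c • x : selfAdjoint A) : A) * a - a * (c • x : selfAdjoint A)
        = (c : ℂ) • ((x : A) * a - a * x) := by
      rw [selfAdjoint.val_smul, smul_mul_assoc, mul_smul_comm, ← smul_sub, Complex.coe_smul]
    change K _ = _
    rw [h, map_smul, hx, selfAdjoint.val_smul, Complex.coe_smul]

/-- The self-adjoint elements commuting with `a`: the Lie algebra of the stabilizer of `a`. -/
def isotropy (a : A) : Submodule ℝ (selfAdjoint A) where
  carrier := {x | Commute (x : A) a}
  zero_mem' := Commute.zero_left a
  add_mem' hx hy := Commute.add_left hx hy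
  smul_mem' c _ hx := Commute.smul_left hx c

theorem mem_tangent {a : A} {K : A →L[ℂ] A} {x : selfAdjoint A} :
    x ∈ tangent a K ↔ K ((x : A) * a - a * x) = x := Iff.rfl

theorem mem_isotropy {a : A} {x : selfAdjoint A} : x ∈ isotropy a ↔ Commute (x : A) a := Iff.rfl

theorem isClosed_tangent (a : A) (K : A →L[ℂ] A) : IsClosed (tangent a K : Set (selfAdjoint A)) :=
  isClosed_eq (by fun_prop) continuous_subtype_val

theorem isClosed_isotropy (a : A) : IsClosed (isotropy a : Set (selfAdjoint A)) :=
  isClosed_eq (by fun_prop) (by fun_prop)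

theorem star_commutator {a b : A} (ha : IsSelfAdjoint a) (hb : IsSelfAdjoint b) :
    star (b * a - a * b) = -(b * a - a * b) := by
  rw [star_sub, star_mul, star_mul, ha.star_eq, hb.star_eq, neg_sub]

/-- The map `b ↦ K (ba - ab)` is an idempotent with range the tangent space and kernel the isotropy
algebra. -/
theorem isCompl_tangent_isotropy {a : A} {K : A →L[ℂ] A} (ha : IsSelfAdjoint a)
    (hK : IsCommutatorQuasiInverse a K) : IsCompl (tangent a K) (isotropy a) := by
  refine IsCompl.of_eq ?_ ?_
  · rw [eq_bot_iff]
    rintro x ⟨hx, hx'⟩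
    rw [SetLike.mem_coe, mem_tangent] at hx
    rw [SetLike.mem_coe, mem_isotropy] at hx'
    rw [hx'.eq, sub_self, map_zero] at hx
    exact (Submodule.mem_bot ℝ).2 (Subtype.ext hx.symm)
  · rw [eq_top_iff]
    intro x _
    have hsa : IsSelfAdjoint (K ((x : A) * a - a * x)) := by
      rw [isSelfAdjoint_iff, hK.star_map, star_commutator ha x.2, map_neg, neg_neg]
    refine Submodule.mem_sup.2 ⟨⟨_, hsa⟩, ?_, x - ⟨_, hsa⟩, ?_, add_sub_cancel _ _⟩
    · exact mem_tangent.2 (hK.map_map _)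
    · rw [mem_isotropy]
      change Commute ((x : A) - K ((x : A) * a - a * x)) a
      rw [hK.map_commutator]
      exact hK.commute_sub _

end Splitting

/-! ### Cayley coordinates adapted to the isotropy algebra -/

section CayleyCoordinates

variable {A : Type u} [CStarAlgebra A]

/-- The inverse Cayley transform as a map from the self-adjoint elements to the unitary group. -/
noncomputable def cayleyUnitary (x : selfAdjoint A) : unitary A :=
  ⟨invCayley (x : A), invCayley_mem_unitary x.2⟩

@[simp] theorem coe_cayleyUnitary (x : selfAdjoint A) :
    (cayleyUnitary x : A) = invCayley (x : A) := rfl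

theorem invCayley_zero : invCayley (0 : A) = 1 := by
  rw [invCayley, sub_zero, add_zero]
  exact Ring.mul_inverse_cancel _ (by simpa using isUnit_I_add (IsSelfAdjoint.zero A))

@[simp] theorem cayleyUnitary_zero : cayleyUnitary (0 : selfAdjoint A) = 1 :=
  Subtype.ext invCayley_zero

theorem invCayley_eq (x : selfAdjoint A) :
    invCayley (x : A) = (2 * Complex.I) • Ring.inverse (Complex.I • (1 : A) + x) - 1 := by
  rw [← one_add_invCayley x.2, add_sub_cancel_left]

theorem contDiff_coe_selfAdjoint : ContDiff ℝ ω fun x : selfAdjoint A => (x : A) :=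
  (selfAdjoint.submodule ℝ A).subtypeL.contDiff

theorem contDiff_invCayley : ContDiff ℝ ω fun x : selfAdjoint A => invCayley (x : A) := by
  simp only [invCayley_eq]
  refine contDiff_iff_contDiffAt.2 fun x => ContDiffAt.sub (ContDiffAt.const_smul _ ?_)
    contDiffAt_const
  exact ContDiffAt.comp (g := (Ring.inverse : A → A)) x (contDiffAt_inverse (isUnit_I_add x.2))
    (contDiffAt_const.add contDiff_coe_selfAdjoint.contDiffAt)

theorem continuous_cayleyUnitary : Continuous (cayleyUnitary : selfAdjoint A → unitary A) :=
  contDiff_invCayley.continuous.subtype_mk _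

theorem hasFDerivAt_invCayley_zero : HasFDerivAt (fun x : selfAdjoint A => invCayley (x : A))
    ((2 * Complex.I) • (selfAdjoint.submodule ℝ A).subtypeL) 0 := by
  have hu : (Complex.I • (1 : A)) * ((-Complex.I) • (1 : A)) = 1 := by
    rw [smul_mul_smul_comm, mul_one]; simp
  have hu' : ((-Complex.I) • (1 : A)) * (Complex.I • (1 : A)) = 1 := by
    rw [smul_mul_smul_comm, mul_one]; simp
  let v : Aˣ := ⟨Complex.I • (1 : A), (-Complex.I) • (1 : A), hu, hu'⟩
  have h1 : HasFDerivAt (Ring.inverse : A → A) (-ContinuousLinearMap.mulLeftRight ℝ A ↑v⁻¹ ↑v⁻¹)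
      (Complex.I • (1 : A) + ((0 : selfAdjoint A) : A)) := by
    rw [ZeroMemClass.coe_zero, add_zero]
    exact hasFDerivAt_ringInverse v
  have h2 : HasFDerivAt (fun x : selfAdjoint A => Complex.I • (1 : A) + (x : A))
      (selfAdjoint.submodule ℝ A).subtypeL 0 :=
    (selfAdjoint.submodule ℝ A).subtypeL.hasFDerivAt.const_add _
  have h3 := ((h1.comp (0 : selfAdjoint A) h2).const_smul (2 * Complex.I)).sub_const (1 : A)
  have e : (fun x : selfAdjoint A => invCayley (x : A)) = fun x : selfAdjoint A =>
    (2 * Complex.I) • Ring.inverse (Complex.I • (1 : A) + (x : A)) - 1 := funext invCayley_eq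
  rw [e]
  refine h3.congr_fderiv ?_
  ext x
  change (2 * Complex.I) • -((((-Complex.I) • (1 : A)) * x) * ((-Complex.I) • (1 : A))) =
    (2 * Complex.I) • (x : A)
  congr 1
  rw [smul_mul_assoc, one_mul, smul_mul_smul_comm, mul_one]
  simp

theorem contDiffAt_cayley {w : A} (hw : IsUnit (1 + w)) : ContDiffAt ℝ ω (cayley : A → A) w := by
  have h : ContDiffAt ℝ ω (fun w : A => Ring.inverse (1 + w)) w :=
    ContDiffAt.comp (g := (Ring.inverse : A → A)) w (contDiffAt_inverse hw)
      (contDiffAt_const.add contDiffAt_id)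
  exact ((contDiffAt_const.sub contDiffAt_id).mul h).const_smul Complex.I

theorem isUnit_one_add_one : IsUnit ((1 : A) + 1) := by
  have := mem_cayleyChart_source (1 : unitary A)
  change IsUnit ((1 : A) + ((1⁻¹ * 1 : unitary A) : A)) at this
  simpa using this

theorem inverse_one_add_one : Ring.inverse ((1 : A) + 1) = (1 / 2 : ℂ) • (1 : A) := by
  refine isUnit_one_add_one.mul_left_cancel ?_
  rw [Ring.mul_inverse_cancel _ isUnit_one_add_one, mul_smul_comm, mul_one, ← two_smul ℂ (1 : A),
    smul_smul]
  norm_num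

theorem hasFDerivAt_cayley_one : HasFDerivAt (cayley : A → A)
    ((-(Complex.I / 2)) • ContinuousLinearMap.id ℝ A) 1 := by
  have h1 : HasFDerivAt (fun w : A => (1 : A) - w) (-ContinuousLinearMap.id ℝ A) 1 :=
    (hasFDerivAt_id (1 : A)).const_sub 1
  have h2 : HasFDerivAt (fun w : A => Ring.inverse (1 + w))
      (fderiv ℝ (fun w : A => Ring.inverse (1 + w)) 1) 1 := by
    have h : ContDiffAt ℝ ω (fun w : A => Ring.inverse (1 + w)) 1 :=
      ContDiffAt.comp (g := (Ring.inverse : A → A)) 1 (contDiffAt_inverse isUnit_one_add_one)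
        (contDiffAt_const.add contDiffAt_id)
    exact (h.differentiableAt (by simp)).hasFDerivAt
  refine ((h1.mul' h2).const_smul Complex.I).congr_fderiv ?_
  ext x
  simp [inverse_one_add_one, smul_smul]
  ring_nf

/-- The map whose local inverse gives coordinates of the unitary group near `1` adapted to a
splitting of the self-adjoint elements: the Cayley transform of a product of inverse Cayley
transforms. -/
noncomputable def cayleyProd {E F : Type*} [NormedAddCommGroup E] [NormedSpace ℝ E]
    [NormedAddCommGroup F] [NormedSpace ℝ F] (e : (E × F) ≃L[ℝ] selfAdjoint A) (p : E × F) :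
    selfAdjoint A :=
  selfAdjointPartL ℝ A (cayley (invCayley (e (p.1, 0) : A) * invCayley (e (0, p.2) : A)))

theorem coe_cayleyProd {E F : Type*} [NormedAddCommGroup E] [NormedSpace ℝ E]
    [NormedAddCommGroup F] [NormedSpace ℝ F] (e : (E × F) ≃L[ℝ] selfAdjoint A) (p : E × F) :
    (cayleyProd e p : A) = cayley (invCayley (e (p.1, 0) : A) * invCayley (e (0, p.2) : A)) :=
  (isSelfAdjoint_cayley (cayleyUnitary (e (p.1, 0)) *
    cayleyUnitary (e (0, p.2))).2).coe_selfAdjointPart_apply ℝ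

theorem hasFDerivAt_cayley_mul {E : Type*} [NormedAddCommGroup E] [NormedSpace ℝ E]
    (f g : E →L[ℝ] selfAdjoint A) :
    HasFDerivAt (fun p : E => selfAdjointPartL ℝ A
      (cayley (invCayley (f p : A) * invCayley (g p : A)))) (f + g) 0 := by
  have h0 : ∀ f : E →L[ℝ] selfAdjoint A, HasFDerivAt (fun p : E => invCayley (f p : A))
      (((2 * Complex.I) • (selfAdjoint.submodule ℝ A).subtypeL).comp f) 0 := fun f => by
    have h : HasFDerivAt (fun x : selfAdjoint A => invCayley (x : A))
        ((2 * Complex.I) • (selfAdjoint.submodule ℝ A).subtypeL) (f 0) := by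
      rw [map_zero]; exact hasFDerivAt_invCayley_zero
    exact h.comp (f := f) (0 : E) f.hasFDerivAt
  have h4 : HasFDerivAt (cayley : A → A) ((-(Complex.I / 2)) • ContinuousLinearMap.id ℝ A)
      (invCayley (f 0 : A) * invCayley (g 0 : A)) := by
    have : invCayley (f 0 : A) * invCayley (g 0 : A) = 1 := by simp [invCayley_zero]
    rw [this]
    exact hasFDerivAt_cayley_one
  have h5 := (selfAdjointPartL ℝ A).hasFDerivAt.comp (0 : E)
    (h4.comp (f := fun p : E => invCayley (f p : A) * invCayley (g p : A)) 0
      ((h0 f).mul' (h0 g)))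
  refine h5.congr_fderiv (ContinuousLinearMap.ext fun p => ?_)
  have e2 : ((-(Complex.I / 2)) • ((2 * Complex.I) • (g p : A) + (2 * Complex.I) • (f p : A))) =
      ((f p + g p : selfAdjoint A) : A) := by
    rw [AddSubgroup.coe_add, ← smul_add, smul_smul, add_comm]
    have : -(Complex.I / 2) * (2 * Complex.I) = 1 := by
      linear_combination (-1 : ℂ) * Complex.I_mul_I
    rw [this, one_smul]
  have e3 : selfAdjointPartL ℝ A ((f p + g p : selfAdjoint A) : A) = f p + g p :=
    Subtype.ext ((f p + g p : selfAdjoint A).2.coe_selfAdjointPart_apply ℝ)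
  rw [add_apply, ← e3, ← e2]
  change selfAdjointPartL ℝ A ((-(Complex.I / 2)) • (invCayley (f 0 : A) *
    ((2 * Complex.I) • (g p : A)) + ((2 * Complex.I) • (f p : A)) * invCayley (g 0 : A))) = _
  rw [map_zero, map_zero, ZeroMemClass.coe_zero, invCayley_zero, one_mul, mul_one]

/-- Near `1`, unitaries factor uniquely and analytically along a splitting of the self-adjoint
elements. -/
theorem exists_factorization_chart {E F : Type*} [NormedAddCommGroup E] [NormedSpace ℝ E]
    [CompleteSpace E] [NormedAddCommGroup F] [NormedSpace ℝ F] [CompleteSpace F]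
    (e : (E × F) ≃L[ℝ] selfAdjoint A) {O : Set E} (hO : IsOpen O) (h0 : 0 ∈ O) :
    ∃ Γ : OpenPartialHomeomorph (E × F) (selfAdjoint A),
      0 ∈ Γ.source ∧ Γ 0 = 0 ∧ (∀ p ∈ Γ.source, p.1 ∈ O) ∧
      ContDiffOn ℝ ω Γ Γ.source ∧ ContDiffOn ℝ ω Γ.symm Γ.target ∧
      ∀ p ∈ Γ.source, cayleyUnitary (Γ p) =
        cayleyUnitary (e (p.1, 0)) * cayleyUnitary (e (0, p.2)) := by
  have hmul : ContDiff ℝ ω fun p : E × F =>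
      invCayley (e (p.1, 0) : A) * invCayley (e (0, p.2) : A) :=
    (contDiff_invCayley.comp (e.contDiff.comp (contDiff_fst.prodMk contDiff_const))).mul
      (contDiff_invCayley.comp (e.contDiff.comp (contDiff_const.prodMk contDiff_snd)))
  set O' : Set (E × F) :=
    {p | IsUnit (1 + invCayley (e (p.1, 0) : A) * invCayley (e (0, p.2) : A))} ∩ Prod.fst ⁻¹' O
    with hO'd
  have hO' : IsOpen O' :=
    (Units.isOpen.preimage (continuous_const.add hmul.continuous)).inter (hO.preimage continuous_fst)
  have he0 : e ((0 : E), (0 : F)) = 0 := map_zero e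
  have h0' : (0 : E × F) ∈ O' := by
    refine ⟨?_, h0⟩
    change IsUnit (1 + invCayley (e ((0 : E), (0 : F)) : A) * invCayley (e ((0 : E), (0 : F)) : A))
    simpa [he0, invCayley_zero] using isUnit_one_add_one (A := A)
  have hf : ∀ p ∈ O', ContDiffAt ℝ ω (cayleyProd e) p := fun p hp =>
    (selfAdjointPartL ℝ A).contDiff.contDiffAt.comp p (ContDiffAt.comp (g := (cayley : A → A)) p
      (contDiffAt_cayley hp.1) hmul.contDiffAt)
  have hd : HasFDerivAt (cayleyProd e) (e : (E × F) →L[ℝ] selfAdjoint A) 0 := by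
    refine (hasFDerivAt_cayley_mul
      ((e : (E × F) →L[ℝ] selfAdjoint A).comp
        ((ContinuousLinearMap.inl ℝ E F).comp (ContinuousLinearMap.fst ℝ E F)))
      ((e : (E × F) →L[ℝ] selfAdjoint A).comp
        ((ContinuousLinearMap.inr ℝ E F).comp (ContinuousLinearMap.snd ℝ E F)))).congr_fderiv ?_
    refine ContinuousLinearMap.ext fun p => ?_
    change e (p.1, 0) + e (0, p.2) = e p
    rw [← map_add]; simp
  obtain ⟨Γ, hΓ0, hΓO, hΓ, hΓ1, hΓ2⟩ := exists_analytic_chart hO' h0' hf e hd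
  refine ⟨Γ, hΓ0, ?_, fun p hp => (hΓO hp).2, ?_, hΓ2, fun p hp => ?_⟩
  · rw [hΓ]
    refine Subtype.ext ?_
    rw [coe_cayleyProd]
    simp [he0, invCayley_zero, cayley]
  · rw [hΓ]; exact hΓ1
  · refine Subtype.ext ?_
    rw [hΓ, coe_cayleyUnitary, coe_cayleyProd]
    exact invCayley_cayley (cayleyUnitary (e (p.1, 0)) * cayleyUnitary (e (0, p.2))).2 (hΓO hp).1

theorem commute_invCayley {a : A} {x : selfAdjoint A} (h : Commute (x : A) a) :
    Commute (invCayley (x : A)) a := by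
  have h1 : Commute (Complex.I • (1 : A)) a := (Commute.one_left a).smul_left _
  exact (h1.sub_left h).mul_left
    (commute_inverse (h1.add_left h).symm (isUnit_I_add x.2)).symm

end CayleyCoordinates

/-! ### The spectrum of an operator of finite rank -/

section FiniteRank

open Polynomial

/-- A finite-rank operator is annihilated by `χ(X) X`, where `χ` is the characteristic polynomial of
its restriction to its range. -/
theorem finite_spectrum_of_finiteRank {H : Type u} [NormedAddCommGroup H] [InnerProductSpace ℂ H]
    (ρ : H →L[ℂ] H) (hfin : FiniteDimensional ℂ ρ.range) :
    (spectrum ℝ ρ).Finite := by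
  set f : ρ.range →ₗ[ℂ] ρ.range :=
    (ρ : H →ₗ[ℂ] H).restrict (fun v _ => LinearMap.mem_range_self _ v) with hf
  have hcoe : ∀ (q : ℂ[X]) (v : ρ.range), ((aeval f q v : ρ.range) : H) = aeval ρ q (v : H) := by
    intro q
    induction q using Polynomial.induction_on' with
    | add p q hp hq => intro v; simp [hp, hq]
    | monomial n c =>
      intro v
      have : ∀ (n : ℕ) (v : ρ.range), (((f ^ n) v : ρ.range) : H) = (ρ ^ n) (v : H) := by
        intro n
        induction n with
        | zero => intro v; simp
        | succ n ih => intro v; rw [pow_succ, pow_succ]; exact ih (f v)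
      simp [aeval_monomial, this, Algebra.algebraMap_eq_smul_one]
  set q : ℂ[X] := f.charpoly * X with hq
  have hq0 : q ≠ 0 := mul_ne_zero f.charpoly_monic.ne_zero X_ne_zero
  have hann : aeval ρ q = 0 := by
    ext x
    have h1 := hcoe f.charpoly ⟨ρ x, LinearMap.mem_range_self _ x⟩
    rw [LinearMap.aeval_self_charpoly] at h1
    rw [hq, map_mul, aeval_X]
    exact h1.symm
  have hC : (spectrum ℂ ρ).Finite := by
    refine (q.rootSet_finite ℂ).subset fun z hz => ?_
    have h1 := spectrum.subset_polynomial_aeval ρ q ⟨z, hz, rfl⟩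
    rw [hann] at h1
    rw [mem_rootSet]
    refine ⟨hq0, ?_⟩
    rw [coe_aeval_eq_eval]
    by_contra hne
    rw [spectrum.mem_iff, sub_zero] at h1
    exact h1 ((IsUnit.mk0 _ hne).map (algebraMap ℂ (H →L[ℂ] H)))
  rw [← spectrum.preimage_algebraMap ℂ]
  exact hC.preimage (algebraMap ℝ ℂ).injective.injOn

end FiniteRank

/-! ### The ideal property of the trace norm -/

section Ideal

variable {H : Type u} [NormedAddCommGroup H] [InnerProductSpace ℂ H] [CompleteSpace H]

/-- With the approximate polar decomposition `A ≈ U S²`, `S² = |A|`, each summand is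
`⟪S U* V eᵢ, S W eᵢ⟫` up to a small error, and the Hilbert-Schmidt norms of `S (U* V)` and `S W` are
bounded by that of `S`. -/
theorem sum_inner_apply_le_of_norm_le_one {A V W : H →L[ℂ] H} (hA : IsTraceClass A) (hV : ‖V‖ ≤ 1)
    (hW : ‖W‖ ≤ 1) (s : Finset (basisSet H)) :
    ∑ i ∈ s, ‖⟪V (onb H i), A (W (onb H i))⟫_ℂ‖ ≤ traceNorm A := by
  have hb := (onb H).orthonormal
  obtain ⟨S, hS, hSS⟩ := exists_sqrt_abs A
  have hN : traceNorm A = ∑' j, ‖S (onb H j)‖ ^ 2 := by simp only [traceNorm, re_abs_eq hS hSS]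
  have hsum : Summable fun j => ‖S (onb H j)‖ ^ 2 := by
    simpa only [IsTraceClass, re_abs_eq hS hSS] using hA
  refine le_of_forall_pos_le_add fun δ hδ => ?_
  set ε : ℝ := δ / (s.card + 1) with hεd
  have hε : 0 < ε := by positivity
  obtain ⟨U, hU, hAU, -⟩ := approx_polar A hε
  have hUV : ‖ContinuousLinearMap.adjoint U * V‖ ≤ 1 := by
    refine (norm_mul_le _ _).trans ?_
    rw [LinearIsometryEquiv.norm_map]
    exact mul_le_one₀ hU (norm_nonneg V) hV
  have hle : ∀ {T : H →L[ℂ] H}, ‖T‖ ≤ 1 → ∀ x, ‖T x‖ ≤ ‖x‖ := fun hT x =>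
    (ContinuousLinearMap.le_opNorm _ x).trans (mul_le_of_le_one_left (norm_nonneg x) hT)
  have hterm : ∀ i ∈ s, ‖⟪V (onb H i), A (W (onb H i))⟫_ℂ‖ ≤
      (‖S ((ContinuousLinearMap.adjoint U * V) (onb H i))‖ ^ 2 + ‖S (W (onb H i))‖ ^ 2) / 2
        + ε := by
    intro i _
    have hbi : ‖onb H i‖ = 1 := hb.1 i
    have h1 : A (W (onb H i)) = U (S (S (W (onb H i)))) + (ε : ℂ) • U (W (onb H i)) := by
      have := congrArg (fun T : H →L[ℂ] H => T (W (onb H i))) hAU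
      rw [← hSS] at this
      simpa using this
    rw [h1, inner_add_right]
    refine (norm_add_le _ _).trans (add_le_add ?_ ?_)
    · rw [← ContinuousLinearMap.adjoint_inner_left, ← inner_selfAdjoint hS]
      refine (norm_inner_le_norm _ _).trans ?_
      rw [mul_apply_eq_comp]
      nlinarith [sq_nonneg (‖S ((ContinuousLinearMap.adjoint U) (V (onb H i)))‖
        - ‖S (W (onb H i))‖)]
    · rw [inner_smul_right, norm_mul, Complex.norm_real, Real.norm_of_nonneg hε.le]
      refine mul_le_of_le_one_right hε.le ((norm_inner_le_norm _ _).trans ?_)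
      have h2 : ‖V (onb H i)‖ ≤ 1 := (hle hV _).trans hbi.le
      have h3 : ‖U (W (onb H i))‖ ≤ 1 := ((hle hU _).trans (hle hW _)).trans hbi.le
      exact mul_le_one₀ h2 (norm_nonneg _) h3
  refine (Finset.sum_le_sum hterm).trans ?_
  rw [Finset.sum_add_distrib, ← Finset.sum_div, Finset.sum_add_distrib, Finset.sum_const,
    nsmul_eq_mul]
  have h1 := sum_norm_sq_le (onb H) hb s hS hUV hsum
  have h2 := sum_norm_sq_le (onb H) hb s hS hW hsum
  have h3 : (s.card : ℝ) * ε ≤ δ := by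
    have h4 : ((s.card : ℝ) + 1) * ε = δ := mul_div_cancel₀ δ (Nat.cast_add_one_ne_zero s.card)
    linarith
  rw [hN]
  linarith

theorem sum_inner_apply_le {A : H →L[ℂ] H} (hA : IsTraceClass A) (V W : H →L[ℂ] H)
    (s : Finset (basisSet H)) :
    ∑ i ∈ s, ‖⟪V (onb H i), A (W (onb H i))⟫_ℂ‖ ≤ ‖V‖ * ‖W‖ * traceNorm A := by
  by_cases hV : V = 0
  · simp [hV]
  by_cases hW : W = 0
  · simp [hW]
  have hV' : ‖V‖ ≠ 0 := norm_ne_zero_iff.2 hV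
  have hW' : ‖W‖ ≠ 0 := norm_ne_zero_iff.2 hW
  have hunit : ∀ {T : H →L[ℂ] H}, ‖T‖ ≠ 0 → ‖((‖T‖⁻¹ : ℝ) : ℂ) • T‖ ≤ 1 := fun {T} hT => by
    rw [norm_smul, Complex.norm_real, norm_inv, norm_norm, inv_mul_cancel₀ hT]
  have h := sum_inner_apply_le_of_norm_le_one hA (hunit hV') (hunit hW') s
  have hterm : ∀ i, ‖⟪V (onb H i), A (W (onb H i))⟫_ℂ‖ = ‖V‖ * ‖W‖ *
      ‖⟪(((‖V‖⁻¹ : ℝ) : ℂ) • V) (onb H i), A ((((‖W‖⁻¹ : ℝ) : ℂ) • W) (onb H i))⟫_ℂ‖ := by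
    intro i
    rw [smul_apply, smul_apply, map_smul, inner_smul_left, inner_smul_right, norm_mul, norm_mul,
      RCLike.norm_conj, Complex.norm_real, Complex.norm_real, norm_inv, norm_inv, norm_norm,
      norm_norm]
    field_simp
  simp only [hterm]
  rw [← Finset.mul_sum]
  gcongr

theorem isTraceClass_mul_left (a : H →L[ℂ] H) {A : H →L[ℂ] H} (hA : IsTraceClass A) :
    IsTraceClass (a * A) ∧ traceNorm (a * A) ≤ ‖a‖ * traceNorm A :=
  isTraceClass_of_bound fun W hW s => by
    have h := sum_inner_apply_le hA (star a * W) 1 s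
    have hterm : ∀ i, ⟪(star a * W) (onb H i), A ((1 : H →L[ℂ] H) (onb H i))⟫_ℂ
        = ⟪W (onb H i), (a * A) (onb H i)⟫_ℂ := fun i => by
      rw [ContinuousLinearMap.star_eq_adjoint, mul_apply_eq_comp, mul_apply_eq_comp,
        one_apply_eq_self, ContinuousLinearMap.adjoint_inner_left]
    simp only [hterm] at h
    refine h.trans (mul_le_mul_of_nonneg_right ?_ (traceNorm_nonneg A))
    calc ‖star a * W‖ * ‖(1 : H →L[ℂ] H)‖ ≤ (‖star a‖ * ‖W‖) * 1 :=
          mul_le_mul (norm_mul_le _ _) ContinuousLinearMap.norm_id_le (norm_nonneg _) (by positivity)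
      _ ≤ ‖a‖ := by rw [norm_star, mul_one]; exact mul_le_of_le_one_right (norm_nonneg a) hW

theorem isTraceClass_mul_right {A : H →L[ℂ] H} (hA : IsTraceClass A) (a : H →L[ℂ] H) :
    IsTraceClass (A * a) ∧ traceNorm (A * a) ≤ ‖a‖ * traceNorm A :=
  isTraceClass_of_bound fun W hW s => by
    refine (sum_inner_apply_le hA W a s).trans ?_
    gcongr
    · exact traceNorm_nonneg A
    · exact mul_le_of_le_one_left (norm_nonneg a) hW

end Ideal

/-! ### Analyticity of the conjugation action -/

section ConjugationAction

variable (A : Type u) [CStarAlgebra A] (T : Type u) [NormedAddCommGroup T] [NormedSpace ℝ T]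
  [MulAction (unitary A) T]

/-- A realization of the Banach space `T` as a real space of self-adjoint elements of `A`, possibly
with a finer norm, on which the unitary group acts by conjugation. The conjugation `B ↦ aBa*` by
arbitrary `a` is not linear in `a`; boundedness is recorded for its linearization
`(a, B) ↦ aB + Ba*` instead. -/
structure ConjugationModel where
  /-- The inclusion of `T` into the algebra. -/
  op : T →L[ℝ] A
  /-- The symmetrized product `(a, B) ↦ aB + Ba*`. -/
  symMul : A →L[ℝ] T →L[ℝ] T
  op_injective : Function.Injective op
  isSelfAdjoint_op (B : T) : IsSelfAdjoint (op B)
  op_symMul (a : A) (B : T) : op (symMul a B) = a * op B + op B * star a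
  op_smul (u : unitary A) (B : T) : op (u • B) = u * op B * star (u : A)

namespace ConjugationModel

variable {A T} (R : ConjugationModel A T)

/-- Conjugation `(a, B) ↦ aBa*` by arbitrary elements of the algebra, obtained from the symmetrized
product by polarization. -/
noncomputable def conj (p : A × T) : T :=
  (1 / 2 : ℝ) • (R.symMul p.1 (R.symMul p.1 p.2) - R.symMul (p.1 * p.1) p.2)

theorem op_conj (p : A × T) : R.op (R.conj p) = p.1 * R.op p.2 * star p.1 := by
  have h : p.1 * (p.1 * R.op p.2 + R.op p.2 * star p.1)
      + (p.1 * R.op p.2 + R.op p.2 * star p.1) * star p.1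
      - (p.1 * p.1 * R.op p.2 + R.op p.2 * star (p.1 * p.1))
      = (2 : ℝ) • (p.1 * R.op p.2 * star p.1) := by
    rw [two_smul, star_mul]; noncomm_ring
  rw [conj, map_smul, map_sub, op_symMul, op_symMul, op_symMul, h, smul_smul]
  norm_num

theorem contDiff_conj : ContDiff ℝ ω R.conj := by
  have h1 : ContDiff ℝ ω fun p : A × T => R.symMul p.1 p.2 :=
    (R.symMul.contDiff.comp contDiff_fst).clm_apply contDiff_snd
  have h2 : ContDiff ℝ ω fun p : A × T => R.symMul p.1 (R.symMul p.1 p.2) :=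
    (R.symMul.contDiff.comp contDiff_fst).clm_apply h1
  have h3 : ContDiff ℝ ω fun p : A × T => R.symMul (p.1 * p.1) p.2 :=
    (R.symMul.contDiff.comp (contDiff_fst.mul contDiff_fst)).clm_apply contDiff_snd
  exact (h2.sub h3).const_smul _

theorem unitary_smul_eq_conj (u : unitary A) (B : T) : u • B = R.conj ((u : A), B) := by
  apply R.op_injective
  rw [R.op_smul, R.op_conj]

theorem contDiff_unitary_smul (R : ConjugationModel A T) (u : unitary A) : ContDiff ℝ ω fun B : T => u • B := by
  simp only [R.unitary_smul_eq_conj]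
  exact R.contDiff_conj.comp (contDiff_const.prodMk contDiff_id)

theorem continuousSMul (R : ConjugationModel A T) : ContinuousSMul (unitary A) T where
  continuous_smul := by
    simp only [R.unitary_smul_eq_conj]
    exact R.contDiff_conj.continuous.comp
      ((continuous_subtype_val.comp continuous_fst).prodMk continuous_snd)

variable {E : Type u} [NormedAddCommGroup E] [NormedSpace ℝ E]

theorem contDiff_cayleyUnitary_smul (R : ConjugationModel A T) (f : E →L[ℝ] selfAdjoint A) (r : T) (j : E →L[ℝ] T) :
    ContDiff ℝ ω fun p : E => cayleyUnitary (f p) • (r + j p) := by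
  simp only [R.unitary_smul_eq_conj]
  exact R.contDiff_conj.comp ((contDiff_invCayley.comp f.contDiff).prodMk
    (contDiff_const.add j.contDiff))

/-- At the origin, the derivative of the action in Cayley coordinates is given by the commutator
with `r` and the identity; it is computed in the algebra, through the injective map `op`. -/
theorem hasFDerivAt_cayleyUnitary_smul (f : E →L[ℝ] selfAdjoint A) (r : T) (j L : E →L[ℝ] T)
    (hL : ∀ p, R.op (L p) = (2 * Complex.I) • ((f p : A) * R.op r - R.op r * f p) + R.op (j p)) :
    HasFDerivAt (fun p : E => cayleyUnitary (f p) • (r + j p)) L 0 := by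
  have hΦ := ((R.contDiff_cayleyUnitary_smul f r j).differentiable (by simp) 0).hasFDerivAt
  refine hΦ.congr_fderiv ?_
  set D := fderiv ℝ (fun p : E => cayleyUnitary (f p) • (r + j p)) 0
  have h1 : HasFDerivAt (fun p : E => (invCayley (f p : A) * R.op (r + j p))
      * star (invCayley (f p : A))) (R.op.comp D) 0 := by
    have := R.op.hasFDerivAt.comp (0 : E) hΦ
    simpa only [Function.comp_def, R.op_smul, coe_cayleyUnitary] using this
  have hg : HasFDerivAt (fun p : E => invCayley (f p : A))
      (((2 * Complex.I) • (selfAdjoint.submodule ℝ A).subtypeL).comp f) 0 := by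
    have h : HasFDerivAt (fun x : selfAdjoint A => invCayley (x : A))
        ((2 * Complex.I) • (selfAdjoint.submodule ℝ A).subtypeL) (f 0) := by
      rw [map_zero]; exact hasFDerivAt_invCayley_zero
    exact h.comp (f := f) (0 : E) f.hasFDerivAt
  have hs := ((starL' ℝ (A := A)) : A →L[ℝ] A).hasFDerivAt.comp (0 : E) hg
  have hj : HasFDerivAt (fun p : E => R.op (r + j p)) (R.op.comp j) 0 :=
    R.op.hasFDerivAt.comp (0 : E) (j.hasFDerivAt.const_add r)
  have h2 := (hg.mul' hj).mul' hs
  have h3 := h1.unique h2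
  refine ContinuousLinearMap.ext fun p => R.op_injective ?_
  have h4 := congrArg (fun S : E →L[ℝ] A => S p) h3
  have hf0 : (f 0 : A) = 0 := by rw [map_zero]; rfl
  have hfp : star (f p : A) = f p := (f p).2.star_eq
  rw [hL]
  calc R.op (D p) = _ := h4
    _ = (invCayley (f 0 : A) * R.op (r + j 0)) * star ((2 * Complex.I) • (f p : A))
        + (invCayley (f 0 : A) * R.op (j p)
          + ((2 * Complex.I) • (f p : A)) * R.op (r + j 0))
          * star (invCayley (f 0 : A)) := rfl
    _ = _ := by
      rw [hf0, invCayley_zero, map_zero, add_zero, star_one, one_mul, one_mul, mul_one, star_smul,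
        hfp, smul_sub, mul_smul_comm, smul_mul_assoc]
      simp only [star_mul', RCLike.star_def, Complex.conj_I, map_ofNat, mul_neg, neg_smul]
      abel

end ConjugationModel

end ConjugationAction

/-! ### Splittings adapted to the orbit -/

section AdaptedSplitting

/-- If `V = p ⊕ q` and `T = D p ⊕ g` with `D` injective on `p`, all subspaces being closed, then `p`
serves as a common coordinate space for the first summands. -/
theorem exists_compatible_splittings {V T : Type u} [NormedAddCommGroup V] [NormedSpace ℝ V]
    [CompleteSpace V] [NormedAddCommGroup T] [NormedSpace ℝ T] [CompleteSpace T]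
    {p q : Submodule ℝ V} (hp : IsClosed (p : Set V)) (hq : IsClosed (q : Set V))
    (hpq : IsCompl p q) (D : V →L[ℝ] T) {g : Submodule ℝ T} (hg : IsClosed (g : Set T))
    (hinj : ∀ x ∈ p, D x ∈ g → x = 0) (hsurj : ∀ t, ∃ x ∈ p, t - D x ∈ g) :
    ∃ (E : Type u) (_ : NormedAddCommGroup E) (_ : NormedSpace ℝ E) (_ : CompleteSpace E)
      (F : Type u) (_ : NormedAddCommGroup F) (_ : NormedSpace ℝ F) (_ : CompleteSpace F)
      (G : Type u) (_ : NormedAddCommGroup G) (_ : NormedSpace ℝ G) (_ : CompleteSpace G)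
      (e : (E × F) ≃L[ℝ] V) (e' : (E × G) ≃L[ℝ] T),
      (∀ k, e (0, k) ∈ q) ∧ (∀ x, e' (x, 0) = D (e (x, 0))) ∧ ∀ y, e' (0, y) ∈ g := by
  have : CompleteSpace p := hp.completeSpace_coe
  have : CompleteSpace q := hq.completeSpace_coe
  have : CompleteSpace g := hg.completeSpace_coe
  set L : (p × g) →L[ℝ] T := (D.comp p.subtypeL).coprod g.subtypeL with hL
  have hLa : ∀ x y, L (x, y) = D x + y := fun x y => rfl
  have hLinj : Function.Injective L := by
    rw [injective_iff_map_eq_zero]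
    rintro ⟨x, y⟩ h
    rw [hLa] at h
    have hx : (x : V) = 0 := hinj x x.2 (by rw [eq_neg_of_add_eq_zero_left h]; exact g.neg_mem y.2)
    rw [hx, map_zero, zero_add] at h
    exact Prod.ext (Subtype.ext hx) (Subtype.ext h)
  have hLsurj : Function.Surjective L := fun t => by
    obtain ⟨x, hx, hxt⟩ := hsurj t
    exact ⟨(⟨x, hx⟩, ⟨_, hxt⟩), add_sub_cancel _ _⟩
  have htop := Submodule.IsCompl.isTopCompl_of_isClosed hpq hp hq
  refine ⟨p, inferInstance, inferInstance, inferInstance, q, inferInstance, inferInstance,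
    inferInstance, g, inferInstance, inferInstance, inferInstance,
    Submodule.prodEquivOfIsTopCompl p q htop,
    ContinuousLinearEquiv.ofBijective L (LinearMap.ker_eq_bot.2 hLinj)
      (LinearMap.range_eq_top.2 hLsurj), fun k => ?_, fun x => ?_, fun y => ?_⟩
  · simp
  · simp [hLa]
  · simp [hLa]

end AdaptedSplitting

/-! ### Slice charts for the orbit -/

section Slice

variable {A : Type u} [CStarAlgebra A] {T : Type u} [NormedAddCommGroup T] [NormedSpace ℝ T]
  [MulAction (unitary A) T]

/-- Coordinates of `T` around `r` in which the orbit of `r` is the slice `E × {0}`, and is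
parametrized there by the unitaries `cayleyUnitary (dom (x, 0))`. The complementary coordinates in
`dom` parametrize unitaries fixing `r`. -/
structure OrbitSlice (r : T) (E F G : Type u) [NormedAddCommGroup E] [NormedSpace ℝ E]
    [NormedAddCommGroup F] [NormedSpace ℝ F] [NormedAddCommGroup G] [NormedSpace ℝ G] where
  /-- The splitting of the self-adjoint elements into orbit directions and isotropy directions. -/
  dom : (E × F) ≃L[ℝ] selfAdjoint A
  /-- The splitting of `T` into the tangent space of the orbit and a complement. -/
  cod : (E × G) ≃L[ℝ] T
  /-- The parametrization of a neighbourhood of `r`. -/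
  chart : OpenPartialHomeomorph (E × G) T
  zero_mem_source : 0 ∈ chart.source
  chart_inl (x : E) : chart (x, 0) = cayleyUnitary (dom (x, 0)) • r
  contDiffOn_chart : ContDiffOn ℝ ω chart chart.source
  contDiffOn_chart_symm : ContDiffOn ℝ ω chart.symm chart.target
  chart_mem_orbit_iff (p : E × G) (hp : p ∈ chart.source) :
    chart p ∈ MulAction.orbit (unitary A) r ↔ p.2 = 0
  cayleyUnitary_inr_smul (k : F) : cayleyUnitary (dom (0, k)) • r = r
  contDiff_smul (u : unitary A) : ContDiff ℝ ω fun B : T => u • B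

/-- The splittings of the self-adjoint elements and of `T` produced by a quasi-inverse of the
commutator with `r`: in `T`, the tangent space of the orbit is complemented by the elements commuting
with `r`. -/
theorem ConjugationModel.exists_splittings [CompleteSpace T] (R : ConjugationModel A T) (r : T)
    {K : A →L[ℂ] A} (hK : IsCommutatorQuasiInverse (R.op r) K) :
    ∃ (E : Type u) (_ : NormedAddCommGroup E) (_ : NormedSpace ℝ E) (_ : CompleteSpace E)
      (F : Type u) (_ : NormedAddCommGroup F) (_ : NormedSpace ℝ F) (_ : CompleteSpace F)
      (G : Type u) (_ : NormedAddCommGroup G) (_ : NormedSpace ℝ G) (_ : CompleteSpace G)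
      (e : (E × F) ≃L[ℝ] selfAdjoint A) (e' : (E × G) ≃L[ℝ] T),
      (∀ k, Commute (e (0, k) : A) (R.op r)) ∧
      (∀ x, R.op (e' (x, 0)) =
        (2 * Complex.I) • ((e (x, 0) : A) * R.op r - R.op r * (e (x, 0) : A))) ∧
      ∀ y, Commute (R.op (e' (0, y))) (R.op r) := by
  set a := R.op r with had
  have ha : IsSelfAdjoint a := R.isSelfAdjoint_op r
  set D : selfAdjoint A →L[ℝ] T := (R.symMul.flip r).comp
    ((2 * Complex.I) • (selfAdjoint.submodule ℝ A).subtypeL) with hDd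
  have hD : ∀ x : selfAdjoint A, R.op (D x) = (2 * Complex.I) • ((x : A) * a - a * x) := by
    intro x
    have hx : star (x : A) = x := x.2.star_eq
    change R.op (R.symMul ((2 * Complex.I) • (x : A)) r) = _
    rw [R.op_symMul, ← had, star_smul, hx, smul_sub, mul_smul_comm, smul_mul_assoc]
    simp only [star_mul', RCLike.star_def, Complex.conj_I, map_ofNat, mul_neg, neg_smul]
    abel
  let g : Submodule ℝ T :=
    { carrier := {y | Commute (R.op y) a}
      zero_mem' := by
        change Commute (R.op 0) a
        rw [map_zero]; exact Commute.zero_left a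
      add_mem' := fun {x y} hx hy => by
        change Commute (R.op (x + y)) a
        rw [map_add]; exact Commute.add_left hx hy
      smul_mem' := fun c x hx => by
        change Commute (R.op (c • x)) a
        rw [map_smul]; exact Commute.smul_left hx c }
  have hgc : IsClosed (g : Set T) :=
    isClosed_eq (f := fun y : T => R.op y * a) (g := fun y : T => a * R.op y)
      (R.op.continuous.mul continuous_const) (continuous_const.mul R.op.continuous)
  have h2I : (2 * Complex.I : ℂ) ≠ 0 := by simp
  have hinj : ∀ x ∈ tangent a K, D x ∈ g → x = 0 := by
    intro x hx hxg
    rw [mem_tangent] at hx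
    have h1 : Commute ((x : A) * a - a * x) a := by
      have h2 : Commute (R.op (D x)) a := hxg
      rw [hD] at h2
      have h3 := h2.smul_left ((2 * Complex.I)⁻¹)
      rwa [smul_smul, inv_mul_cancel₀ h2I, one_smul] at h3
    have h4 := hK.map_commutator ((x : A) * a - a * x)
    rw [h1.eq, sub_self, map_zero, hx] at h4
    rw [← h4, map_zero] at hx
    exact Subtype.ext hx.symm
  have hsurj : ∀ t, ∃ x ∈ tangent a K, t - D x ∈ g := by
    intro t
    have hsa : IsSelfAdjoint ((-(Complex.I / 2)) • K (R.op t)) := by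
      rw [isSelfAdjoint_iff, star_smul, hK.star_map, (R.isSelfAdjoint_op t).star_eq, smul_neg,
        ← neg_smul]
      congr 1
      simp [neg_div]
    have hc : (-(Complex.I / 2)) • K (R.op t) * a - a * ((-(Complex.I / 2)) • K (R.op t))
        = (-(Complex.I / 2)) • (K (R.op t) * a - a * K (R.op t)) := by
      rw [smul_sub, mul_smul_comm, smul_mul_assoc]
    refine ⟨⟨_, hsa⟩, ?_, ?_⟩
    · rw [mem_tangent]
      change K ((-(Complex.I / 2)) • K (R.op t) * a - a * ((-(Complex.I / 2)) • K (R.op t))) = _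
      rw [hc, map_smul, hK.map_map]
    · change Commute (R.op (t - D _)) a
      have h1 : (2 * Complex.I) * (-(Complex.I / 2)) = 1 := by
        linear_combination (-1 : ℂ) * Complex.I_mul_I
      rw [map_sub, hD]
      change Commute (R.op t - (2 * Complex.I) • ((-(Complex.I / 2)) • K (R.op t) * a
        - a * ((-(Complex.I / 2)) • K (R.op t)))) a
      rw [hc, smul_smul, h1, one_smul]
      exact hK.commute_sub _
  obtain ⟨E, _, _, _, F, _, _, _, G, _, _, _, e, e', h1, h2, h3⟩ :=
    exists_compatible_splittings (isClosed_tangent a K) (isClosed_isotropy a)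
      (isCompl_tangent_isotropy ha hK) D hgc hinj hsurj
  exact ⟨E, _, _, ‹_›, F, _, _, ‹_›, G, _, _, ‹_›, e, e', h1, fun x => by rw [h2, hD], h3⟩

theorem spectrum_unitary_conj (u : unitary A) (a : A) :
    spectrum ℝ ((u : A) * a * star (u : A)) = spectrum ℝ a :=
  Unitary.spectrum_star_right_conjugate

/-- The map `(x, y) ↦ c(x) (r + y) c(x)*`, with `c(x)` an inverse Cayley transform and `y` commuting
with `r`, is a local diffeomorphism. Its value lies on the orbit of `r` only if `r + y` does; as
`r + y` commutes with `r` and has the same finite spectrum, this forces `y = 0`. -/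
theorem ConjugationModel.exists_orbitSlice [CompleteSpace T] (R : ConjugationModel A T) (r : T)
    (hfin : (spectrum ℝ (R.op r)).Finite) :
    ∃ (E : Type u) (_ : NormedAddCommGroup E) (_ : NormedSpace ℝ E) (_ : CompleteSpace E)
      (F : Type u) (_ : NormedAddCommGroup F) (_ : NormedSpace ℝ F) (_ : CompleteSpace F)
      (G : Type u) (_ : NormedAddCommGroup G) (_ : NormedSpace ℝ G) (_ : CompleteSpace G),
      Nonempty (OrbitSlice (A := A) r E F G) := by
  set a := R.op r with had
  have ha : IsSelfAdjoint a := R.isSelfAdjoint_op r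
  -- `0` is thrown in only to make the set nonempty
  set s : Finset ℝ := insert 0 hfin.toFinset with hsd
  have hs : spectrum ℝ a ⊆ s := fun x hx => by
    rw [hsd, Finset.coe_insert, Set.Finite.coe_toFinset]; exact Or.inr hx
  have hne : s.Nonempty := Finset.insert_nonempty _ _
  obtain ⟨K, hK⟩ := exists_commutator_quasiInverse ha hs hne
  obtain ⟨E, _, _, _, F, _, _, _, G, _, _, _, e, e', h1, h2, h3⟩ :=
    R.exists_splittings r hK
  refine ⟨E, inferInstance, inferInstance, inferInstance, F, inferInstance, inferInstance,
    inferInstance, G, inferInstance, inferInstance, inferInstance, ?_⟩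
  set f : (E × G) →L[ℝ] selfAdjoint A := (e : (E × F) →L[ℝ] selfAdjoint A).comp
    ((ContinuousLinearMap.inl ℝ E F).comp (ContinuousLinearMap.fst ℝ E G)) with hf
  set j : (E × G) →L[ℝ] T := (e' : (E × G) →L[ℝ] T).comp
    ((ContinuousLinearMap.inr ℝ E G).comp (ContinuousLinearMap.snd ℝ E G)) with hj
  have hfa : ∀ p, f p = e (p.1, 0) := fun p => rfl
  have hja : ∀ p, j p = e' (0, p.2) := fun p => rfl
  have hd := R.hasFDerivAt_cayleyUnitary_smul f r j (e' : (E × G) →L[ℝ] T) fun p => by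
    have : p = (p.1, 0) + (0, p.2) := by simp
    conv_lhs => rw [this, map_add, map_add]
    rw [hfa, hja]
    exact congrArg (· + R.op (e' (0, p.2))) (h2 p.1)
  set O : Set (E × G) := {p | IsUnit (intertwiner s a (R.op (r + j p)))} with hO
  have hOo : IsOpen O := Units.isOpen.preimage
    ((continuous_intertwiner s a).comp (R.op.continuous.comp (continuous_const.add j.continuous)))
  have h0 : (0 : E × G) ∈ O := by
    change IsUnit _
    rw [map_zero, add_zero, ← had, intertwiner_self ha hs hne]
    exact isUnit_one
  obtain ⟨Θ, hΘ0, hΘO, hΘ, hΘ1, hΘ2⟩ := exists_analytic_chart hOo h0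
    (fun p _ => (R.contDiff_cayleyUnitary_smul f r j).contDiffAt) e' hd
  refine ⟨⟨e, e', Θ, hΘ0, fun x => ?_, by rw [hΘ]; exact hΘ1, hΘ2, fun p hp => ?_, fun k => ?_,
    R.contDiff_unitary_smul⟩⟩
  · have h : j (x, 0) = 0 := map_zero e'
    rw [hΘ]
    change cayleyUnitary (e (x, 0)) • (r + j (x, 0)) = _
    rw [h, add_zero]
  · have hiff : Θ p ∈ MulAction.orbit (unitary A) r ↔ r + j p ∈ MulAction.orbit (unitary A) r := by
      rw [hΘ, MulAction.mem_orbit_symm, MulAction.mem_orbit_symm (a₁ := r + j p),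
        MulAction.orbit_smul]
    rw [hiff]
    constructor
    · rintro ⟨u, hu⟩
      have hu' : R.op (r + j p) = u * a * star (u : A) := by rw [← R.op_smul]; exact congrArg _ hu.symm
      have hcomm : Commute (R.op (r + j p)) a := by
        rw [map_add]; exact (Commute.refl a).add_left (h3 p.2)
      have hsp : spectrum ℝ (R.op (r + j p)) ⊆ s := by
        rw [hu', spectrum_unitary_conj]; exact hs
      have := eq_of_commute_of_isUnit_intertwiner ha hs (R.isSelfAdjoint_op _) hsp hcomm (hΘO hp)
      have h4 : j p = 0 := add_eq_left.1 (R.op_injective this)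
      have h5 : ((0 : E), p.2) = 0 := e'.injective (by rw [← hja, h4, map_zero])
      exact congrArg Prod.snd h5
    · intro h
      have h4 : j p = 0 := by rw [hja, h]; exact map_zero e'
      rw [h4, add_zero]
      exact MulAction.mem_orbit_self r
  · apply R.op_injective
    rw [R.op_smul, coe_cayleyUnitary, (commute_invCayley (h1 k)).eq, mul_assoc, ← coe_cayleyUnitary,
      Unitary.mul_star_self_of_mem (cayleyUnitary (e (0, k))).2, mul_one]

end Slice

/-! ### The homogeneous space and its embedding -/

section Geometry

open Manifold

theorem trans_mem_maximalAtlas {V M : Type*} [NormedAddCommGroup V] [NormedSpace ℝ V]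
    [TopologicalSpace M] [ChartedSpace V M] [IsManifold 𝓘(ℝ, V) ω M]
    {c : OpenPartialHomeomorph M V} (hc : c ∈ IsManifold.maximalAtlas 𝓘(ℝ, V) ω M)
    (g : OpenPartialHomeomorph V V) (hg : ContDiffOn ℝ ω g g.source)
    (hg' : ContDiffOn ℝ ω g.symm g.target) :
    c ≫ₕ g ∈ IsManifold.maximalAtlas 𝓘(ℝ, V) ω M := by
  obtain ⟨h1, h2⟩ := (IsManifold.mem_maximalAtlas_iff_contMDiffOn c).1 hc
  refine (c ≫ₕ g).mem_maximalAtlas_of_contMDiffOn ?_ ?_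
  · rw [OpenPartialHomeomorph.trans_source]
    exact hg.contMDiffOn.comp' h1
  · rw [OpenPartialHomeomorph.trans_target]
    exact h2.comp' hg'.contMDiffOn

theorem continuous_ofQuotientStabilizer {U X : Type*} [Group U] [TopologicalSpace U]
    [TopologicalSpace X] [MulAction U X] [ContinuousSMul U X] (x : X) :
    Continuous (MulAction.ofQuotientStabilizer U x) :=
  continuous_quot_lift _ (continuous_id.smul continuous_const)

variable {A : Type u} [CStarAlgebra A] {T : Type u} [NormedAddCommGroup T] [NormedSpace ℝ T]
  [MulAction (unitary A) T] {r : T}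
  {E F G : Type u} [NormedAddCommGroup E] [NormedSpace ℝ E] [NormedAddCommGroup F]
  [NormedSpace ℝ F] [NormedAddCommGroup G] [NormedSpace ℝ G]

namespace OrbitSlice

variable (S : OrbitSlice (A := A) r E F G)

theorem chart_zero : S.chart 0 = r := by
  have h := S.chart_inl 0
  have h0 : S.dom ((0 : E), (0 : F)) = 0 := map_zero S.dom
  rwa [h0, cayleyUnitary_zero, one_smul] at h

/-- Points of the orbit near `r` are moved to by unitaries near `1`. -/
theorem exists_unitary_near_one (S : OrbitSlice (A := A) r E F G) {ε : ℝ} (hε : 0 < ε) :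
    ∃ δ : ℝ, 0 < δ ∧ ∀ u : unitary A, ‖u • r - r‖ < δ →
      ∃ v : unitary A, ‖(v : A) - 1‖ < ε ∧ v • r = u • r := by
  have hr : r ∈ S.chart.target := by
    have := S.chart.map_source S.zero_mem_source
    rwa [chart_zero] at this
  have hsymm : S.chart.symm r = 0 := by
    have := S.chart.left_inv S.zero_mem_source
    rwa [chart_zero] at this
  set f : T → A := fun t => (cayleyUnitary (S.dom ((S.chart.symm t).1, 0)) : A) with hf
  have hfr : f r = 1 := by
    have h0 : S.dom ((0 : E), (0 : F)) = 0 := map_zero S.dom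
    rw [hf]
    simp [hsymm, h0]
  have hc : ContinuousAt f r := by
    have h1 : Continuous fun p : E × G => (cayleyUnitary (S.dom (p.1, 0)) : A) :=
      continuous_subtype_val.comp (continuous_cayleyUnitary.comp
        (S.dom.continuous.comp (continuous_fst.prodMk continuous_const)))
    exact h1.continuousAt.comp (S.chart.continuousAt_symm hr)
  have hev : ∀ᶠ t in 𝓝 r, t ∈ S.chart.target ∧ ‖f t - 1‖ < ε := by
    refine Filter.Eventually.and (S.chart.open_target.mem_nhds hr) ?_
    have h2 : Filter.Tendsto f (𝓝 r) (𝓝 1) := hfr ▸ hc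
    have := Metric.tendsto_nhds.1 h2 ε hε
    simpa only [dist_eq_norm] using this
  obtain ⟨δ, hδ, h⟩ := Metric.eventually_nhds_iff.1 hev
  refine ⟨δ, hδ, fun u hu => ?_⟩
  obtain ⟨ht, hn⟩ := h (y := u • r) (by rwa [dist_eq_norm])
  refine ⟨_, hn, ?_⟩
  have h2 : (S.chart.symm (u • r)).2 = 0 := by
    rw [← S.chart_mem_orbit_iff _ (S.chart.map_target ht), S.chart.right_inv ht]
    exact MulAction.mem_orbit r u
  rw [← S.chart_inl, ← h2]
  exact S.chart.right_inv ht

variable [ContinuousSMul (unitary A) T]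

/-- The slice chart at `r`, transported to `u • r`. -/
noncomputable def chartAt (u : unitary A) : OpenPartialHomeomorph T (E × G) :=
  (Homeomorph.smul u⁻¹).toOpenPartialHomeomorph ≫ₕ S.chart.symm

theorem chartAt_symm_apply (u : unitary A) (p : E × G) :
    (S.chartAt u).symm p = u • S.chart p := by
  change (Homeomorph.smul u⁻¹).symm (S.chart p) = _
  rw [Homeomorph.symm_apply_eq]
  exact (inv_smul_smul u _).symm

theorem chartAt_source (u : unitary A) :
    (S.chartAt u).source = (fun t : T => u⁻¹ • t) ⁻¹' S.chart.target := by
  simp [chartAt]; rfl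

theorem chartAt_target (u : unitary A) : (S.chartAt u).target = S.chart.source := by
  simp [chartAt]

theorem smul_mem_chartAt_source (u : unitary A) : u • r ∈ (S.chartAt u).source := by
  rw [chartAt_source, Set.mem_preimage, inv_smul_smul]
  have := S.chart.map_source S.zero_mem_source
  rwa [chart_zero] at this

theorem contDiffOn_chartAt (u : unitary A) :
    ContDiffOn ℝ ω (S.chartAt u) (S.chartAt u).source := by
  rw [chartAt_source]
  exact S.contDiffOn_chart_symm.comp (S.contDiff_smul u⁻¹).contDiffOn fun _ h => h

theorem contDiffOn_chartAt_symm (u : unitary A) :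
    ContDiffOn ℝ ω (S.chartAt u).symm (S.chartAt u).target := by
  rw [chartAt_target]
  exact ((S.contDiff_smul u).comp_contDiffOn S.contDiffOn_chart).congr
    fun p _ => S.chartAt_symm_apply u p

theorem mem_orbit_iff (u : unitary A) {t : T} (ht : t ∈ (S.chartAt u).source) :
    t ∈ MulAction.orbit (unitary A) r ↔ (S.chartAt u t).2 = 0 := by
  rw [← S.chart_mem_orbit_iff _ (by rw [← S.chartAt_target u]; exact (S.chartAt u).map_source ht)]
  have h := S.chartAt_symm_apply u (S.chartAt u t)
  rw [(S.chartAt u).left_inv ht] at h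
  conv_lhs => rw [h]
  rw [MulAction.mem_orbit_symm, MulAction.mem_orbit_symm (a₁ := S.chart _), MulAction.orbit_smul]

theorem isAnalyticSubmanifold_orbit [CompleteSpace E] [CompleteSpace G]
    (S : OrbitSlice (A := A) r E F G) :
    IsAnalyticSubmanifold (MulAction.orbit (unitary A) r) := by
  rintro _ ⟨u, rfl⟩
  exact ⟨E, inferInstance, inferInstance, inferInstance, G, inferInstance, inferInstance,
    inferInstance, S.chartAt u, S.smul_mem_chartAt_source u, S.contDiffOn_chartAt u,
    S.contDiffOn_chartAt_symm u, fun t ht => S.mem_orbit_iff u ht⟩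

/-- The chart of the homogeneous space around the class of `u`: the first component of the slice
chart at `u • r`. -/
noncomputable def quotientChart (u : unitary A) :
    OpenPartialHomeomorph (unitary A ⧸ MulAction.stabilizer (unitary A) r) E :=
  have hmk : ∀ x, (x, 0) ∈ S.chart.source → MulAction.ofQuotientStabilizer (unitary A) r
      (u * cayleyUnitary (S.dom (x, 0)) : unitary A) = (S.chartAt u).symm (x, 0) := fun x _ => by
    rw [MulAction.ofQuotientStabilizer_mk, mul_smul, ← S.chart_inl, chartAt_symm_apply]
  have hcont := continuous_ofQuotientStabilizer (U := unitary A) r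
  { toFun q := (S.chartAt u (MulAction.ofQuotientStabilizer (unitary A) r q)).1
    invFun x := (u * cayleyUnitary (S.dom (x, 0)) : unitary A)
    source := MulAction.ofQuotientStabilizer (unitary A) r ⁻¹' (S.chartAt u).source
    target := {x | (x, 0) ∈ S.chart.source}
    map_source' q hq := by
      have h := (S.mem_orbit_iff u hq).1 (MulAction.ofQuotientStabilizer_mem_orbit _ r q)
      have h2 := (S.chartAt u).map_source hq
      rw [chartAt_target] at h2
      change (_, (0 : G)) ∈ S.chart.source
      rwa [← h]
    map_target' x hx := by
      rw [Set.mem_preimage, hmk x hx]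
      exact (S.chartAt u).map_target (by rw [chartAt_target]; exact hx)
    left_inv' q hq := by
      have h := (S.mem_orbit_iff u hq).1 (MulAction.ofQuotientStabilizer_mem_orbit _ r q)
      have h2 := (S.chartAt u).map_source hq
      rw [chartAt_target] at h2
      apply MulAction.injective_ofQuotientStabilizer (unitary A) r
      rw [hmk _ (by rwa [← h]), ← h]
      exact (S.chartAt u).left_inv hq
    right_inv' x hx := by
      rw [hmk x hx, (S.chartAt u).right_inv (by rw [chartAt_target]; exact hx)]
    open_source := (S.chartAt u).open_source.preimage hcont
    open_target := S.chart.open_source.preimage (continuous_id.prodMk continuous_const)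
    continuousOn_toFun := continuous_fst.comp_continuousOn
      ((S.chartAt u).continuousOn.comp hcont.continuousOn fun _ h => h)
    continuousOn_invFun := (continuous_quot_mk.comp (continuous_const.mul
      (continuous_cayleyUnitary.comp (S.dom.continuous.comp
        (continuous_id.prodMk continuous_const))))).continuousOn }

theorem quotientChart_symm_apply (u : unitary A) (x : E) :
    (S.quotientChart u).symm x = (u * cayleyUnitary (S.dom (x, 0)) : unitary A) := rfl

theorem mem_quotientChart_target (u : unitary A) {x : E} :
    x ∈ (S.quotientChart u).target ↔ (x, 0) ∈ S.chart.source := Iff.rfl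

theorem mem_quotientChart_source (u : unitary A) :
    (u : unitary A ⧸ MulAction.stabilizer (unitary A) r) ∈ (S.quotientChart u).source :=
  S.smul_mem_chartAt_source u

theorem ofQuotientStabilizer_quotientChart_symm (u : unitary A) (x : E) :
    MulAction.ofQuotientStabilizer (unitary A) r ((S.quotientChart u).symm x) =
      (S.chartAt u).symm (x, 0) := by
  rw [quotientChart_symm_apply, MulAction.ofQuotientStabilizer_mk, mul_smul, ← S.chart_inl,
    chartAt_symm_apply]

/-- The first component of a slice chart is defined on an open set of `T`, not only on the orbit;
it provides a local continuous left inverse of the inclusion. -/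
theorem isEmbedding_ofQuotientStabilizer (S : OrbitSlice (A := A) r E F G) :
    Topology.IsEmbedding (MulAction.ofQuotientStabilizer (unitary A) r) := by
  set ι := MulAction.ofQuotientStabilizer (unitary A) r with hι
  refine ⟨Topology.isInducing_iff_nhds.2 fun q => le_antisymm
    (Filter.map_le_iff_le_comap.1 (continuous_ofQuotientStabilizer r).continuousAt) ?_,
    MulAction.injective_ofQuotientStabilizer (unitary A) r⟩
  obtain ⟨u, rfl⟩ := QuotientGroup.mk_surjective q
  have hu : ι u ∈ (S.chartAt u).source := S.smul_mem_chartAt_source u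
  set ψ : T → unitary A ⧸ MulAction.stabilizer (unitary A) r :=
    fun t => (S.quotientChart u).symm (S.chartAt u t).1 with hψ
  have hψι : ∀ q, ι q ∈ (S.chartAt u).source → ψ (ι q) = q := fun q hq =>
    (S.quotientChart u).left_inv hq
  have hc : ContinuousAt ψ (ι u) := by
    refine ContinuousAt.comp (g := (S.quotientChart u).symm) ?_
      (continuous_fst.continuousAt.comp ((S.chartAt u).continuousAt hu))
    exact (S.quotientChart u).continuousAt_symm
      ((S.quotientChart u).map_source (S.mem_quotientChart_source u))
  have h1 : Filter.Tendsto (ψ ∘ ι) (Filter.comap ι (𝓝 (ι u))) (𝓝 (u : unitary A ⧸ _)) := by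
    have h := hc.tendsto.comp (Filter.tendsto_comap (f := ι) (x := 𝓝 (ι u)))
    rwa [hψι _ hu] at h
  have h2 : ψ ∘ ι =ᶠ[Filter.comap ι (𝓝 (ι u))] id :=
    Filter.mem_of_superset (Filter.preimage_mem_comap ((S.chartAt u).open_source.mem_nhds hu))
      fun q hq => hψι q hq
  exact Filter.tendsto_id'.1 (h1.congr' h2)

/-- The manifold structure of the homogeneous space, with one chart for each unitary. -/
@[reducible] noncomputable def chartedSpace (S : OrbitSlice (A := A) r E F G) :
    ChartedSpace E (unitary A ⧸ MulAction.stabilizer (unitary A) r) where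
  atlas := Set.range S.quotientChart
  chartAt q := S.quotientChart (Quotient.out q)
  mem_chart_source q := by
    have := S.mem_quotientChart_source (Quotient.out q)
    rwa [QuotientGroup.out_eq'] at this
  chart_mem_atlas q := ⟨_, rfl⟩

theorem isManifold (S : OrbitSlice (A := A) r E F G) :
    letI := S.chartedSpace
    IsManifold 𝓘(ℝ, E) ω (unitary A ⧸ MulAction.stabilizer (unitary A) r) := by
  let := S.chartedSpace
  refine isManifold_of_contDiffOn _ _ _ ?_
  rintro _ _ ⟨u, rfl⟩ ⟨v, rfl⟩
  simp only [modelWithCornersSelf_coe, modelWithCornersSelf_coe_symm, Function.comp_id,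
    Function.id_comp, Set.preimage_id, Set.range_id, Set.inter_univ]
  have h1 : ContDiffOn ℝ ω (fun x : E => (S.chartAt u).symm (x, 0)) (S.quotientChart u).target :=
    (S.contDiffOn_chartAt_symm u).comp (contDiff_id.prodMk contDiff_const).contDiffOn
      fun x hx => by rw [chartAt_target]; exact hx
  have h2 : ∀ x, (S.quotientChart u).symm x ∈ (S.quotientChart v).source →
      (S.chartAt u).symm (x, 0) ∈ (S.chartAt v).source := fun x hx => by
    rwa [← S.ofQuotientStabilizer_quotientChart_symm]
  refine (contDiff_fst.comp_contDiffOn ((S.contDiffOn_chartAt v).comp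
    (h1.mono fun x hx => hx.1) fun x hx => h2 x hx.2)).congr fun x hx => ?_
  change (S.chartAt v (MulAction.ofQuotientStabilizer (unitary A) r
    ((S.quotientChart u).symm x))).1 = _
  rw [ofQuotientStabilizer_quotientChart_symm]
  rfl

theorem quotientChart_mem_maximalAtlas (u : unitary A) :
    letI := S.chartedSpace
    S.quotientChart u ∈ IsManifold.maximalAtlas 𝓘(ℝ, E) ω
      (unitary A ⧸ MulAction.stabilizer (unitary A) r) := by
  let := S.chartedSpace
  have := S.isManifold
  exact IsManifold.subset_maximalAtlas ⟨u, rfl⟩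

/-- In the slice chart at `u • r` and the corresponding chart of the homogeneous space, the inclusion
is `x ↦ (x, 0)`. -/
theorem isImmersion (S : OrbitSlice (A := A) r E F G) :
    letI := S.chartedSpace
    IsImmersion 𝓘(ℝ, E) 𝓘(ℝ, T) ω (MulAction.ofQuotientStabilizer (unitary A) r) := by
  let := S.chartedSpace
  refine ⟨G, inferInstance, inferInstance, fun q => ?_⟩
  obtain ⟨u, rfl⟩ := QuotientGroup.mk_surjective q
  set g : OpenPartialHomeomorph T T :=
    S.chartAt u ≫ₕ S.cod.toHomeomorph.toOpenPartialHomeomorph with hg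
  have hgs : g.source = (S.chartAt u).source := by simp [hg]
  have hgt : g.target = S.cod.symm ⁻¹' (S.chartAt u).target := by simp [hg]
  have hmem : g ∈ IsManifold.maximalAtlas 𝓘(ℝ, T) ω T := by
    refine g.mem_maximalAtlas_of_contMDiffOn ?_ ?_
    · rw [hgs]
      exact (S.cod.contDiff.comp_contDiffOn (S.contDiffOn_chartAt u)).contMDiffOn
    · rw [hgt]
      exact ((S.contDiffOn_chartAt_symm u).comp S.cod.symm.contDiff.contDiffOn
        fun _ h => h).contMDiffOn
  refine IsImmersionAtOfComplement.mk_of_charts S.cod (S.quotientChart u) g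
    (S.mem_quotientChart_source u) ?_ (S.quotientChart_mem_maximalAtlas u) hmem ?_ fun x hx => ?_
  · rw [hgs]; exact S.smul_mem_chartAt_source u
  · rw [hgs]; exact subset_rfl
  · have hx' : (x, (0 : G)) ∈ (S.chartAt u).target := by
      rw [chartAt_target, ← S.mem_quotientChart_target u]
      simpa using hx
    change S.cod (S.chartAt u (MulAction.ofQuotientStabilizer (unitary A) r
      ((S.quotientChart u).symm x))) = S.cod (x, 0)
    rw [ofQuotientStabilizer_quotientChart_symm, (S.chartAt u).right_inv hx']

/-- In the coordinates of the unitary group given by the factorization along the isotropy algebra,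
the projection is `(x, k) ↦ x`. -/
theorem isSubmersion [CompleteSpace E] [CompleteSpace F] (S : OrbitSlice (A := A) r E F G) :
    letI := S.chartedSpace
    IsSubmersion 𝓘(ℝ, selfAdjoint A) 𝓘(ℝ, E) ω
      (fun u : unitary A => (u : unitary A ⧸ MulAction.stabilizer (unitary A) r)) := by
  let := S.chartedSpace
  refine ⟨F, inferInstance, inferInstance, fun u => ?_⟩
  obtain ⟨Γ, hΓ0, hΓ00, hΓO, hΓ1, hΓ2, hΓ⟩ := exists_factorization_chart S.dom
    (S.chart.open_source.preimage (f := fun x : E => (x, (0 : G)))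
      (continuous_id.prodMk continuous_const)) S.zero_mem_source
  set g : OpenPartialHomeomorph (selfAdjoint A) (selfAdjoint A) :=
    Γ.symm ≫ₕ S.dom.toHomeomorph.toOpenPartialHomeomorph with hg
  have hgs : g.source = Γ.target := by simp [hg]
  have hgt : g.target = S.dom.symm ⁻¹' Γ.source := by simp [hg]
  have hmem : cayleyChart u ≫ₕ g ∈
      IsManifold.maximalAtlas 𝓘(ℝ, selfAdjoint A) ω (unitary A) := by
    refine trans_mem_maximalAtlas (IsManifold.chart_mem_maximalAtlas u) g ?_ ?_
    · rw [hgs]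
      exact S.dom.contDiff.comp_contDiffOn hΓ2
    · rw [hgt]
      exact hΓ1.comp S.dom.symm.contDiff.contDiffOn fun _ h => h
  have hu0 : cayleyChart u u = 0 := by
    apply Subtype.ext
    change cayley ((u⁻¹ * u : unitary A) : A) = 0
    simp [cayley]
  refine IsSubmersionAtOfComplement.mk_of_continuousAt continuous_quot_mk.continuousAt S.dom.symm
    (cayleyChart u ≫ₕ g) (S.quotientChart u) ?_ (S.mem_quotientChart_source u) hmem
    (S.quotientChart_mem_maximalAtlas u) fun a ha => ?_
  · rw [OpenPartialHomeomorph.trans_source, hgs]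
    refine ⟨mem_cayleyChart_source u, ?_⟩
    rw [Set.mem_preimage, hu0, ← hΓ00]
    exact Γ.map_source hΓ0
  · set p := S.dom.symm a with hp
    have hpΓ : p ∈ Γ.source := by
      have : a ∈ (cayleyChart u ≫ₕ g).target := by simpa using ha
      rw [OpenPartialHomeomorph.trans_target, hgt] at this
      exact this.1
    -- the isotropy factor of the unitary disappears in the quotient
    have hmk : ((u * cayleyUnitary (Γ p) : unitary A) :
        unitary A ⧸ MulAction.stabilizer (unitary A) r) = (S.quotientChart u).symm p.1 := by
      rw [hΓ p hpΓ, quotientChart_symm_apply, ← mul_assoc, QuotientGroup.eq]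
      rw [mul_inv_rev, inv_mul_cancel_right, inv_mem_iff, MulAction.mem_stabilizer_iff]
      exact S.cayleyUnitary_inr_smul p.2
    change S.quotientChart u ((u * cayleyUnitary (Γ p) : unitary A) :
        unitary A ⧸ MulAction.stabilizer (unitary A) r) = p.1
    rw [hmk, (S.quotientChart u).right_inv (hΓO p hpΓ)]

end OrbitSlice

end Geometry

/-! ### The trace class as a conjugation model -/

namespace SATraceClass

variable {H : Type u} [NormedAddCommGroup H] [InnerProductSpace ℂ H] [CompleteSpace H]

/-- The symmetrized product `(a, B) ↦ aB + Ba*` on the self-adjoint trace-class operators. -/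
noncomputable def symMul : (H →L[ℂ] H) →L[ℝ] SATraceClass H →L[ℝ] SATraceClass H :=
  LinearMap.mkContinuous₂ (LinearMap.mk₂ ℝ
    (fun (a : H →L[ℂ] H) (B : SATraceClass H) => mk (a * B.op + B.op * star a)
      (by rw [isSelfAdjoint_iff, star_add, star_mul, star_mul, star_star, B.isSelfAdjoint.star_eq,
        add_comm])
      (isTraceClass_add (isTraceClass_mul_left a B.isTraceClass).1
        (isTraceClass_mul_right B.isTraceClass (star a)).1).1)
    (fun a b B => by ext1; simp only [op_mk, op_add, star_add, add_mul, mul_add]; abel)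
    (fun c a B => by
      ext1
      simp only [op_mk, op_smul, star_smul, star_trivial, smul_mul_assoc, mul_smul_comm, smul_add])
    (fun a B C => by ext1; simp only [op_mk, op_add, add_mul, mul_add]; abel)
    (fun c a B => by ext1; simp only [op_mk, op_smul, smul_mul_assoc, mul_smul_comm, smul_add]))
    2 fun a B => by
      have h1 := isTraceClass_mul_left a B.isTraceClass
      have h2 := isTraceClass_mul_right B.isTraceClass (star a)
      have h3 := (isTraceClass_add h1.1 h2.1).2
      rw [norm_star] at h2
      calc _ ≤ _ := h3
        _ ≤ ‖a‖ * traceNorm B.op + ‖a‖ * traceNorm B.op := add_le_add h1.2 h2.2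
        _ = 2 * ‖a‖ * ‖B‖ := by rw [norm_def]; ring

/-- The self-adjoint trace-class operators, with the trace norm, among the bounded operators. -/
noncomputable def conjugationModel : ConjugationModel (H →L[ℂ] H) (SATraceClass H) where
  op := LinearMap.mkContinuous { toFun := op, map_add' := op_add, map_smul' := op_smul } 1
    fun A => by rw [one_mul]; exact norm_op_le A
  symMul := symMul
  op_injective _ _ h := ext h
  isSelfAdjoint_op B := B.isSelfAdjoint
  op_symMul _ _ := rfl
  op_smul := op_unitary_smul

end SATraceClass

end UnitaryOrbit
open UnitaryOrbit Manifold in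
theorem theorem2p6 {H : Type u} [NormedAddCommGroup H] [InnerProductSpace ℂ H] [CompleteSpace H]
    (ρ : H →L[ℂ] H) (hρ0 : ρ ≠ 0) (hρ : IsSelfAdjoint ρ) (hfin : FiniteDimensional ℂ ρ.range) :
    let r : SATraceClass H := SATraceClass.ofFiniteRank ρ hρ hfin
    let ι : unitary (H →L[ℂ] H) ⧸ MulAction.stabilizer (unitary (H →L[ℂ] H)) r → SATraceClass H :=
      MulAction.ofQuotientStabilizer (unitary (H →L[ℂ] H)) r
    -- the orbit is a submanifold of the Banach space of self-adjoint trace-class operators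
    IsAnalyticSubmanifold (MulAction.orbit (unitary (H →L[ℂ] H)) r) ∧
    -- with the analytic structure of the homogeneous space, its inclusion is a regular embedding
    (∃ (M : Type u) (_ : NormedAddCommGroup M) (_ : NormedSpace ℝ M) (_ : CompleteSpace M)
      (_ : ChartedSpace M (unitary (H →L[ℂ] H) ⧸ MulAction.stabilizer (unitary (H →L[ℂ] H)) r)),
      IsManifold 𝓘(ℝ, M) ω
        (unitary (H →L[ℂ] H) ⧸ MulAction.stabilizer (unitary (H →L[ℂ] H)) r) ∧
      IsSubmersion 𝓘(ℝ, selfAdjoint (H →L[ℂ] H)) 𝓘(ℝ, M) ω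
        (fun u : unitary (H →L[ℂ] H) =>
          (u : unitary (H →L[ℂ] H) ⧸ MulAction.stabilizer (unitary (H →L[ℂ] H)) r)) ∧
      IsSmoothEmbedding 𝓘(ℝ, M) 𝓘(ℝ, SATraceClass H) ω ι) ∧
    -- points of the orbit close to `ρ` in trace norm are moved to by unitaries close to `1`
    (∀ ε : ℝ, 0 < ε → ∃ δ : ℝ, 0 < δ ∧ ∀ u : unitary (H →L[ℂ] H), ‖u • r - r‖ < δ →
      ∃ v : unitary (H →L[ℂ] H), ‖(v : H →L[ℂ] H) - 1‖ < ε ∧ v • r = u • r) ∧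
    -- the quotient topology agrees with the relative trace-norm topology
    Topology.IsEmbedding ι := by
  intro r ι
  have := (SATraceClass.conjugationModel (H := H)).continuousSMul
  obtain ⟨E, _, _, _, F, _, _, _, G, _, _, _, ⟨S⟩⟩ :=
    SATraceClass.conjugationModel.exists_orbitSlice r
      (finite_spectrum_of_finiteRank ρ hfin)
  let := S.chartedSpace
  exact ⟨S.isAnalyticSubmanifold_orbit,
    ⟨E, inferInstance, inferInstance, inferInstance, inferInstance, S.isManifold, S.isSubmersion,
      S.isImmersion, S.isEmbedding_ofQuotientStabilizer⟩,
    fun ε hε => S.exists_unitary_near_one hε, S.isEmbedding_ofQuotientStabilizer⟩
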